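/- **Setting.** Let $d\ge 1$, $p\ge 1$, and let $\Omega\subset\mathbb R^d$ be a bounded polyhedral Lipschitz domain with a conforming initial triangulation $\mathcal T_0$ into compact simplices. Let $f\in L^2(\Omega)$, $\boldsymbol f\in L^2(\Omega)^d$, $\boldsymbol b\in L^\infty(\Omega)^d$, $c\in L^\infty(\Omega)$ with $\operatorname{div}\boldsymbol b\in L^\infty(\Omega)$ and $-\operatorname{div}\boldsymbol b+2c\ge 0$ a.e., and let $\boldsymbol K\in L^\infty(\Omega)^{d\times d}$ be symmetric and uniformly positive definite, with $\boldsymbol f|_T\in H^1(T)^d$ and $\boldsymbol K|_T\in W^{1,\infty}(T)^{d\times d}$ for all $T\in\mathcal T_0$. For $v,w\in H^1_0(\Omega)$ put $a(v,w)=\langle\boldsymbol K\nabla v,\nabla w\rangle$, $b(v,w)=a(v,w)+\langle\boldsymbol b\cdot\nabla v,w\rangle+\langle cv,w\rangle$, $F(v)=\langle f,v\rangle+\langle\boldsymbol f,\nabla v\rangle$ (all in $L^2(\Omega)$) and $|||v|||=a(v,v)^{1/2}$. Let $u^\star\in H^1_0(\Omega)$ solve $b(u^\star,v)=F(v)$ for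 all $v\in H^1_0(\Omega)$. For a triangulation $\mathcal T_H$ generated from $\mathcal T_0$ by newest vertex bisection (NVB), with the usual control of the local mesh ratio if $d=1$, let $\mathcal X_H$ be the space of continuous $\mathcal T_H$-piecewise polynomials of degree at most $p$ in $H^1_0(\Omega)$, let $u_H^\star\in\mathcal X_H$ be the Galerkin solution, i.e. $b(u_H^\star,v)=F(v)$ for all $v\in\mathcal X_H$, and let $\eta_H(\mathcal U,v)=\big(\sum_{T\in\mathcal U}\eta_H(T,v)^2\big)^{1/2}$ for $\mathcal U\subseteq\mathcal T_H$, $\eta_H(v)=\eta_H(\mathcal T_H,v)$, be the residual estimator $$\eta_H(T,v)^2=|T|^{2/d}\,\|\operatorname{div}(\boldsymbol K\nabla v-\boldsymbol f)-\boldsymbol b\cdot\nabla v-cv+f\|_{L^2(T)}^2+|T|^{1/d}\,\|[\![(\boldsymbol K\nabla v-\boldsymbol f)\cdot n]\!]\|_{L^2(\partial T\cap\Omega)}^2 .$$ **Assumption on the estimator.** There are $C_{\rm stab},C_{\rm rel}>0$ and $0<q_{\rm red}<1$ such that, for all NVB triangulations $\mathcal T_H$ generated from $\mathcal T_0$, all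 NVB refinements $\mathcal T_h$ of $\mathcal T_H$ and all $v_H\in\mathcal X_H$, $v_h\in\mathcal X_h$: (A1) $|\eta_h(\mathcal T_h\cap\mathcal T_H,v_h)-\eta_H(\mathcal T_h\cap\mathcal T_H,v_H)|\le C_{\rm stab}|||v_h-v_H|||$; (A2) $\eta_h(\mathcal T_h\setminus\mathcal T_H,v_H)\le q_{\rm red}\,\eta_H(\mathcal T_H\setminus\mathcal T_h,v_H)$; (A3) $|||u^\star-u_H^\star|||\le C_{\rm rel}\,\eta_H(u_H^\star)$. **Algorithm.** Input: $\mathcal T_0$, $0<\theta\le 1$, $C_{\rm mark}\ge 1$, $u_0^0\in\mathcal X_0$, $C_{\rm alg}>0$, $\lambda_{\rm alg}>0$, a restart length $k_{\max}\ge 1$, and $S:=0$. For $\ell=0,1,2,\dots$, with the Galerkin matrix $B_\ell$ and load vector $d_\ell$ with respect to a basis of $\mathcal X_\ell$ and a symmetric positive definite preconditioner $P_\ell$, do the following. (i) Starting from $u_\ell^0$ with coefficient vector $x_\ell^0$, compute iterates $u_\ell^k$ with coefficient vectors $x_\ell^k$, $k=1,2,\dots$, by the preconditioned GMRES method for $B_\ell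 x=d_\ell$ in the inner product $(P_\ell^{-1}\cdot,\cdot)_2$, with modified Gram–Schmidt Arnoldi process and restart after every $k_{\max}$ steps, until $\|s_\ell^k\|_{P_\ell^{-1}}\le\lambda_{\rm alg}\,\eta_\ell(u_\ell^k)$, where $s_\ell^k=P_\ell(d_\ell-B_\ell x_\ell^k)$ and $\|y\|_{P_\ell^{-1}}=(P_\ell^{-1}y,y)_2^{1/2}$. Let $\underline k\ge 1$ be the first such $k$; if there is none, the iteration on level $\ell$ continues indefinitely. (ii) Let $H_\ell=\eta_\ell(u_\ell^{\underline k})+\|s_\ell^{\underline k}\|_{P_\ell^{-1}}$. If $\ell\ge 1$ and $S>C_{\rm alg}H_\ell^{-1}$, replace $C_{\rm alg}$ by $2C_{\rm alg}$ and $\lambda_{\rm alg}$ by $\lambda_{\rm alg}/2$. Then replace $S$ by $S+H_\ell^{-1}$ (with $1/0=\infty$). (iii) Choose $\mathcal M_\ell\subseteq\mathcal T_\ell$ with $\theta\,\eta_\ell(u_\ell^{\underline k})^2\le\eta_\ell(\mathcal M_\ell,u_\ell^{\underline k})^2$ whose cardinality is at most $C_{\rm mark}$ times the minimal cardinality of such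 sets. (iv) Let $\mathcal T_{\ell+1}$ be the coarsest NVB refinement of $\mathcal T_\ell$ in which all elements of $\mathcal M_\ell$ are refined, and $u_{\ell+1}^0:=u_\ell^{\underline k}$. There is no termination by a tolerance. Let $\mathcal Q$ be the set of all $(\ell,k)\in\mathbb N_0^2$ such that $u_\ell^k$ appears in the algorithm, and let $|\ell,k|$ be the number of elements of $\mathcal Q$ that are lexicographically not larger than $(\ell,k)$. **Assumption on the preconditioner.** There is $C_{\rm pre}\ge 1$ such that, for all levels $\ell$ and all $v\in\mathcal X_\ell$ with coefficient vector $x$, $C_{\rm pre}^{-1}|||v|||\le\|x\|_{P_\ell^{-1}}\le C_{\rm pre}|||v|||$. **Corollary 5.5.** Under these assumptions, for arbitrary $0<\theta\le1$, $C_{\rm mark}\ge1$, $u_0^0\in\mathcal X_0$, $\lambda_{\rm alg}>0$, $C_{\rm alg}>0$ and $k_{\max}\ge1$, there holds $$|||u^\star-u_\ell^k|||+|||u^\star-u_\ell^\star|||+|||u_\ell^\star-u_\ell^k|||+\eta_\ell(u_\ell^\star)+\eta_\ell(u_\ell^k)\longrightarrow 0\quad\text{as }|\ell,k|\to\infty,\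 (\ell,k)\in\mathcal Q .$$ -/

import Mathlib

open MeasureTheory Filter Topology Matrix
open scoped ENNReal ContDiff RealInnerProductSpace

noncomputable section

namespace AFEM

/-- The Euclidean space `ℝᵈ`. -/
abbrev E (d : ℕ) := EuclideanSpace ℝ (Fin d)

/-! ### Test functions, weak derivatives, normal traces, Sobolev space -/

/-- `φ ∈ C_c^∞(U)`. -/
def IsTest {d : ℕ} (U : Set (E d)) (φ : E d → ℝ) : Prop :=
  ContDiff ℝ ∞ φ ∧ HasCompactSupport φ ∧ tsupport φ ⊆ U

/-- `G` is the weak gradient of `g` on the open set `U`. -/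
def HasWeakGrad {d : ℕ} (U : Set (E d)) (g : E d → ℝ) (G : E d → E d) : Prop :=
  ∀ φ, IsTest U φ → ∫ x in U, g x • gradient φ x = -∫ x in U, φ x • G x

/-- `δ` is the weak divergence of the vector field `σ` on the open set `U`. -/
def HasWeakDiv {d : ℕ} (U : Set (E d)) (σ : E d → E d) (δ : E d → ℝ) : Prop :=
  ∀ φ, IsTest U φ → ∫ x in U, ⟪σ x, gradient φ x⟫ = -∫ x in U, δ x * φ x

open Classical in
/-- The square-integrable weak divergence of `σ` on the open set `U` (unique almost everywhere;
zero if there is none). -/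
def weakDiv {d : ℕ} (U : Set (E d)) (σ : E d → E d) : E d → ℝ :=
  if h : ∃ δ : E d → ℝ, MemLp δ 2 (volume.restrict U) ∧ HasWeakDiv U σ δ then h.choose else 0

/-- `g` is the outer normal trace `σ · n` on the boundary of the convex body `T`, in the sense
of Green's formula. -/
def IsNormalTrace {d : ℕ} (T : Set (E d)) (σ : E d → E d) (g : E d → ℝ) : Prop :=
  ∀ φ, IsTest Set.univ φ →
    ∫ x in interior T, (⟪σ x, gradient φ x⟫ + weakDiv (interior T) σ x * φ x) =
      ∫ x in frontier T, g x * φ x ∂μHE[d - 1]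

open Classical in
/-- The square-integrable outer normal trace of `σ` on the boundary of `T` (unique almost
everywhere with respect to the surface measure; zero if there is none). -/
def normalTrace {d : ℕ} (T : Set (E d)) (σ : E d → E d) : E d → ℝ :=
  if h : ∃ g : E d → ℝ, MemLp g 2 ((μHE[d - 1] : Measure (E d)).restrict (frontier T)) ∧
    IsNormalTrace T σ g then h.choose else 0

/-- `L²(Ω) × L²(Ω; ℝᵈ)` with its Hilbert space structure. -/
abbrev L2Pair {d : ℕ} (Ω : Set (E d)) :=
  WithLp 2 (Lp ℝ 2 (volume.restrict Ω) × Lp (E d) 2 (volume.restrict Ω))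

/-- The Sobolev space `H¹₀(Ω)`: the closure of `{(φ, ∇φ) : φ ∈ C_c^∞(Ω)}` in the `H¹`-norm.
Its elements are the pairs consisting of a function and its weak gradient. -/
def h10 {d : ℕ} (Ω : Set (E d)) : Submodule ℝ (L2Pair Ω) :=
  (Submodule.span ℝ {w : L2Pair Ω | ∃ φ, IsTest Ω φ ∧
    w.fst =ᵐ[volume.restrict Ω] φ ∧ w.snd =ᵐ[volume.restrict Ω] gradient φ}).topologicalClosure

abbrev H10 {d : ℕ} (Ω : Set (E d)) := ↥(h10 Ω)

/-- The function underlying an element of `H¹₀(Ω)`. -/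
def H10.val {d : ℕ} {Ω : Set (E d)} (v : H10 Ω) : E d → ℝ := (v : L2Pair Ω).fst

/-- The weak gradient of an element of `H¹₀(Ω)`. -/
def H10.grad {d : ℕ} {Ω : Set (E d)} (v : H10 Ω) : E d → E d := (v : L2Pair Ω).snd

/-- Bounded Lipschitz domain: open, connected, non-empty, bounded and, near each boundary point
and in a suitable direction `e`, the strict epigraph of a Lipschitz function on `e^⊥`
(extended to the whole space so as to be constant along `e`). -/
structure IsLipschitzDomain {d : ℕ} (Ω : Set (E d)) : Prop where
  isOpen : IsOpen Ω
  isConnected : IsConnected Ω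
  isBounded : Bornology.IsBounded Ω
  boundary : ∀ x ∈ frontier Ω, ∃ (e : E d) (g : E d → ℝ) (L : NNReal) (r : ℝ),
    ‖e‖ = 1 ∧ LipschitzWith L g ∧ (∀ y (t : ℝ), g (y + t • e) = g y) ∧ 0 < r ∧
      ∀ y ∈ Metric.ball x r, (y ∈ Ω ↔ g y < ⟪e, y⟫)

/-! ### Simplicial meshes and newest vertex bisection -/

/-- A tagged simplex `(z₀, …, z_d)_γ`. The order of the vertices and the type `γ` determine
how it and its descendants are bisected; the refinement edge joins `z₀` and `z_d`. -/
structure Simplex (d : ℕ) where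
  vert : Fin (d + 1) → E d
  type : ℕ

/-- The closed simplex as a set. -/
def Simplex.carrier {d : ℕ} (T : Simplex d) : Set (E d) := convexHull ℝ (Set.range T.vert)

/-- The midpoint of the refinement edge. -/
def Simplex.newVertex {d : ℕ} (T : Simplex d) : E d :=
  midpoint ℝ (T.vert 0) (T.vert (Fin.last d))

/-- First child: `(z₀, m, z₁, …, z_{d-1})_{γ+1 mod d}`, with `m` the new vertex. -/
def Simplex.child₁ {d : ℕ} (T : Simplex d) : Simplex d where
  vert i :=
    if (i : ℕ) = 0 then T.vert 0
    else if (i : ℕ) = 1 then T.newVertex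
    else T.vert ⟨i - 1, by omega⟩
  type := (T.type + 1) % d

/-- Second child: `(z_d, m, z₁, …, z_γ, z_{d-1}, …, z_{γ+1})_{γ+1 mod d}`, with `m` the new
vertex. -/
def Simplex.child₂ {d : ℕ} (T : Simplex d) : Simplex d where
  vert i :=
    if (i : ℕ) = 0 then T.vert (Fin.last d)
    else if (i : ℕ) = 1 then T.newVertex
    else if h : (i : ℕ) ≤ T.type + 1 then T.vert ⟨i - 1, by omega⟩
    else T.vert ⟨d + T.type + 1 - i, by omega⟩
  type := (T.type + 1) % d

abbrev Mesh (d : ℕ) := Finset (Simplex d)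

/-- Two elements meet in the convex hull of their common vertices, i.e. in a common subsimplex
(or not at all); so there are no hanging nodes. -/
def IsConforming {d : ℕ} (𝒯 : Mesh d) : Prop :=
  ∀ T ∈ 𝒯, ∀ T' ∈ 𝒯,
    T.carrier ∩ T'.carrier = convexHull ℝ (Set.range T.vert ∩ Set.range T'.vert)

/-- Conforming triangulation of `Ω` into compact, non-degenerate tagged simplices. -/
structure IsTriangulation {d : ℕ} (Ω : Set (E d)) (𝒯 : Mesh d) : Prop where
  nondegenerate : ∀ T ∈ 𝒯, AffineIndependent ℝ T.vert
  type_lt : ∀ T ∈ 𝒯, T.type < d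
  conforming : IsConforming 𝒯
  disjoint : ∀ T ∈ 𝒯, ∀ T' ∈ 𝒯, T ≠ T' →
    Disjoint (interior T.carrier) (interior T'.carrier)
  cover : ⋃ T ∈ 𝒯, T.carrier = closure Ω

open Classical in
/-- `𝒯'` arises from `𝒯` by bisection of a single element. -/
def BisectsOne {d : ℕ} (𝒯 𝒯' : Mesh d) : Prop :=
  ∃ T ∈ 𝒯, 𝒯' = 𝒯.erase T ∪ {T.child₁, T.child₂}

/-- `𝒯'` arises from `𝒯` by finitely many bisections. -/
def Bisects {d : ℕ} : Mesh d → Mesh d → Prop := Relation.ReflTransGen BisectsOne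

/-- The sizes of neighbouring elements of `𝒯` differ at most by a factor `2 κ`, where `κ ≥ 1`
is the corresponding maximal factor in `𝒯₀`. -/
def IsGraded {d : ℕ} (𝒯₀ 𝒯 : Mesh d) : Prop :=
  ∀ κ : ℝ,
    (∀ T ∈ 𝒯₀, ∀ T' ∈ 𝒯₀, (T.carrier ∩ T'.carrier).Nonempty →
      volume.real T'.carrier ≤ κ * volume.real T.carrier) →
    ∀ T ∈ 𝒯, ∀ T' ∈ 𝒯, (T.carrier ∩ T'.carrier).Nonempty →
      volume.real T'.carrier ≤ 2 * κ * volume.real T.carrier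

/-- The triangulations generated from `𝒯₀` by newest vertex bisection. In one dimension, where
conformity is void, bisection is accompanied, as usual, by the control of the local mesh ratio. -/
def NVBMesh {d : ℕ} (𝒯₀ 𝒯 : Mesh d) : Prop :=
  Bisects 𝒯₀ 𝒯 ∧ IsConforming 𝒯 ∧ (d = 1 → IsGraded 𝒯₀ 𝒯)

/-- `𝒯' = refine(𝒯, ℳ)`: the coarsest newest vertex bisection refinement of `𝒯` in which all
elements of `ℳ` are refined. -/
structure IsRefine {d : ℕ} (𝒯₀ 𝒯 ℳ 𝒯' : Mesh d) : Prop where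
  mesh : NVBMesh 𝒯₀ 𝒯'
  bisects : Bisects 𝒯 𝒯'
  refined : Disjoint ℳ 𝒯'
  coarsest : ∀ 𝒯'', NVBMesh 𝒯₀ 𝒯'' → Bisects 𝒯 𝒯'' → Disjoint ℳ 𝒯'' → Bisects 𝒯' 𝒯''

/-! ### Model problem -/

/-- Domain and data of the problem
`-div(K ∇u) + b · ∇u + c u = f - div F` in `Ω`, `u = 0` on `∂Ω`. -/
structure Problem (d : ℕ) where
  Ω : Set (E d)
  K : E d → Matrix (Fin d) (Fin d) ℝ
  b : E d → E d
  c : E d → ℝ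
  f : E d → ℝ
  F : E d → E d

/-- Standing assumptions on the domain, the data and the initial triangulation. -/
structure Problem.IsAdmissible {d : ℕ} (D : Problem d) (𝒯₀ : Mesh d) : Prop where
  domain : IsLipschitzDomain D.Ω
  triangulation : IsTriangulation D.Ω 𝒯₀
  memLp_f : MemLp D.f 2 (volume.restrict D.Ω)
  memLp_F : MemLp D.F 2 (volume.restrict D.Ω)
  memLp_K : ∀ i j, MemLp (fun x => D.K x i j) ∞ (volume.restrict D.Ω)
  memLp_b : MemLp D.b ∞ (volume.restrict D.Ω)
  memLp_c : MemLp D.c ∞ (volume.restrict D.Ω)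
  symm_K : ∀ᵐ x ∂volume.restrict D.Ω, (D.K x).IsSymm
  elliptic_K : ∃ κ : ℝ, 0 < κ ∧ ∀ᵐ x ∂volume.restrict D.Ω,
    ∀ ξ : E d, κ * ‖ξ‖ ^ 2 ≤ ⟪(D.K x).toEuclideanLin ξ, ξ⟫
  /-- `div b ∈ L^∞(Ω)` and `-div b + 2 c ≥ 0`. -/
  div_b : ∃ δ : E d → ℝ, MemLp δ ∞ (volume.restrict D.Ω) ∧ HasWeakDiv D.Ω D.b δ ∧
    ∀ᵐ x ∂volume.restrict D.Ω, 0 ≤ -δ x + 2 * D.c x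
  /-- `F|_T ∈ H¹(T)ᵈ` for all initial elements. -/
  regular_F : ∀ T ∈ 𝒯₀, ∀ i, ∃ G : E d → E d,
    MemLp G 2 (volume.restrict (interior T.carrier)) ∧
      HasWeakGrad (interior T.carrier) (fun x => D.F x i) G
  /-- `K|_T ∈ W^{1,∞}(T)^{d × d}` for all initial elements. -/
  regular_K : ∀ T ∈ 𝒯₀, ∀ i j, ∃ G : E d → E d,
    MemLp G ∞ (volume.restrict (interior T.carrier)) ∧
      HasWeakGrad (interior T.carrier) (fun x => D.K x i j) G

/-- The principal part `a(v, w) = ⟨K ∇v, ∇w⟩`. -/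
def Problem.a {d : ℕ} (D : Problem d) (v w : H10 D.Ω) : ℝ :=
  ∫ x in D.Ω, ⟪(D.K x).toEuclideanLin (v.grad x), w.grad x⟫

/-- The bilinear form `b(v, w) = a(v, w) + ⟨b · ∇v, w⟩ + ⟨c v, w⟩`. -/
def Problem.form {d : ℕ} (D : Problem d) (v w : H10 D.Ω) : ℝ :=
  D.a v w + (∫ x in D.Ω, ⟪D.b x, v.grad x⟫ * w.val x) + ∫ x in D.Ω, D.c x * v.val x * w.val x

/-- The right-hand side `F(v) = ⟨f, v⟩ + ⟨F, ∇v⟩`. -/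
def Problem.rhs {d : ℕ} (D : Problem d) (v : H10 D.Ω) : ℝ :=
  (∫ x in D.Ω, D.f x * v.val x) + ∫ x in D.Ω, ⟪D.F x, v.grad x⟫

/-- The energy norm `a(v, v)^{1/2}`. -/
def Problem.enorm {d : ℕ} (D : Problem d) (v : H10 D.Ω) : ℝ := √(D.a v v)

/-- `u ∈ W` and `b(u, v) = F(v)` for all `v ∈ W`. For `W = ⊤`, this is the weak formulation. -/
def Problem.IsSolutionIn {d : ℕ} (D : Problem d) (W : Submodule ℝ (H10 D.Ω)) (u : H10 D.Ω) :
    Prop :=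
  u ∈ W ∧ ∀ v ∈ W, D.form u v = D.rhs v

/-- The finite element space `S₀ᵖ(𝒯)`: the elements of `H¹₀(Ω)` that are continuous on the closure
of `Ω` and coincide on each element of `𝒯` with a polynomial of total degree at most `p`. -/
def feSpace {d : ℕ} (Ω : Set (E d)) (p : ℕ) (𝒯 : Mesh d) : Submodule ℝ (H10 Ω) where
  carrier := {v | ∃ w : E d → ℝ, v.val =ᵐ[volume.restrict Ω] w ∧ ContinuousOn w (closure Ω) ∧
    ∀ T ∈ 𝒯, ∃ q : MvPolynomial (Fin d) ℝ, q.totalDegree ≤ p ∧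
      ∀ x ∈ T.carrier, w x = MvPolynomial.eval (fun i => x i) q}
  zero_mem' := by
    refine ⟨0, ?_, continuousOn_const, fun T _ => ⟨0, by simp, by simp⟩⟩
    exact Lp.coeFn_zero ℝ 2 _
  add_mem' := by
    rintro v v' ⟨w, hw, hc, hq⟩ ⟨w', hw', hc', hq'⟩
    refine ⟨w + w', ?_, hc.add hc', fun T hT => ?_⟩
    · exact (Lp.coeFn_add (v : L2Pair Ω).fst (v' : L2Pair Ω).fst).trans (hw.add hw')
    · obtain ⟨q, hd, he⟩ := hq T hT
      obtain ⟨q', hd', he'⟩ := hq' T hT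
      exact ⟨q + q', (MvPolynomial.totalDegree_add q q').trans (max_le hd hd'),
        fun x hx => by simp [he x hx, he' x hx]⟩
  smul_mem' := by
    rintro r v ⟨w, hw, hc, hq⟩
    refine ⟨r • w, ?_, hc.const_smul r, fun T hT => ?_⟩
    · exact (Lp.coeFn_smul r (v : L2Pair Ω).fst).trans (hw.const_smul r)
    · obtain ⟨q, hd, he⟩ := hq T hT
      exact ⟨r • q, (MvPolynomial.totalDegree_smul_le r q).trans hd,
        fun x hx => by simp [he x hx, MvPolynomial.smul_eval]⟩

/-! ### Residual error estimator -/

/-- The flux `K ∇v - F`. -/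
def Problem.flux {d : ℕ} (D : Problem d) (v : H10 D.Ω) (x : E d) : E d :=
  (D.K x).toEuclideanLin (v.grad x) - D.F x

/-- The element residual `div(K ∇v - F) - b · ∇v - c v + f` on `T`. -/
def Problem.residual {d : ℕ} (D : Problem d) (T : Simplex d) (v : H10 D.Ω) (x : E d) : ℝ :=
  weakDiv (interior T.carrier) (D.flux v) x - ⟪D.b x, v.grad x⟫ - D.c x * v.val x + D.f x

/-- The jump `[[(K ∇v - F) · n]]`: at almost every point of a facet in `Ω`, it is the sum of the
outer normal traces from the two elements that share the facet. -/
def Problem.jump {d : ℕ} (D : Problem d) (𝒯 : Mesh d) (v : H10 D.Ω) (x : E d) : ℝ :=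
  ∑ T ∈ 𝒯, (frontier T.carrier).indicator (normalTrace T.carrier (D.flux v)) x

/-- The squared refinement indicator `η(T, v)²` with respect to the mesh `𝒯`. -/
def Problem.etaSq {d : ℕ} (D : Problem d) (𝒯 : Mesh d) (T : Simplex d) (v : H10 D.Ω) : ℝ :=
  volume.real T.carrier ^ (2 / d : ℝ) * (∫ x in T.carrier, D.residual T v x ^ 2) +
    volume.real T.carrier ^ (1 / d : ℝ) *
      ∫ x in frontier T.carrier ∩ D.Ω, D.jump 𝒯 v x ^ 2 ∂μHE[d - 1]

/-- The estimator `η(𝒰, v)` for `𝒰 ⊆ 𝒯`, with respect to the mesh `𝒯`. -/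
def Problem.eta {d : ℕ} (D : Problem d) (𝒯 𝒰 : Mesh d) (v : H10 D.Ω) : ℝ :=
  √(∑ T ∈ 𝒰, D.etaSq 𝒯 T v)

open Classical in
/-- The estimator satisfies stability (A1), reduction (A2) and reliability (A3), with constants
that are uniform over all triangulations `𝒯H` generated from `𝒯₀` and all refinements `𝒯h` of
`𝒯H`. -/
def Problem.EstimatorAxioms {d : ℕ} (D : Problem d) (p : ℕ) (𝒯₀ : Mesh d) : Prop :=
  ∃ Cstab Crel qred : ℝ, 0 < Cstab ∧ 0 < Crel ∧ 0 < qred ∧ qred < 1 ∧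
    (∀ 𝒯H 𝒯h, NVBMesh 𝒯₀ 𝒯H → NVBMesh 𝒯₀ 𝒯h → Bisects 𝒯H 𝒯h →
      ∀ vH ∈ feSpace D.Ω p 𝒯H, ∀ vh ∈ feSpace D.Ω p 𝒯h,
        |D.eta 𝒯h (𝒯h ∩ 𝒯H) vh - D.eta 𝒯H (𝒯h ∩ 𝒯H) vH| ≤ Cstab * D.enorm (vh - vH)) ∧
    (∀ 𝒯H 𝒯h, NVBMesh 𝒯₀ 𝒯H → NVBMesh 𝒯₀ 𝒯h → Bisects 𝒯H 𝒯h →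
      ∀ vH ∈ feSpace D.Ω p 𝒯H,
        D.eta 𝒯h (𝒯h \ 𝒯H) vH ≤ qred * D.eta 𝒯H (𝒯H \ 𝒯h) vH) ∧
    (∀ 𝒯H, NVBMesh 𝒯₀ 𝒯H → ∀ u uH, D.IsSolutionIn ⊤ u →
      D.IsSolutionIn (feSpace D.Ω p 𝒯H) uH → D.enorm (u - uH) ≤ Crel * D.eta 𝒯H 𝒯H uH)

/-! ### Preconditioned GMRES with restart -/

/-- `‖s‖_{P⁻¹} = (P⁻¹ s, s)₂^{1/2}`. -/
def precNorm {N : ℕ} (P : Matrix (Fin N) (Fin N) ℝ) (s : Fin N → ℝ) : ℝ := √((P⁻¹ *ᵥ s) ⬝ᵥ s)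

/-- The number of GMRES steps since the last restart, including step `k ≥ 1`. -/
def gmresK (kmax k : ℕ) : ℕ := (k - 1) % kmax + 1

/-- The index of the last iterate before step `k ≥ 1` at which GMRES was (re)started. -/
def gmresStart (kmax k : ℕ) : ℕ := (k - 1) / kmax * kmax

/-- The pair `(w̃, w)` in step `k` after `j` orthogonalization steps of modified Gram-Schmidt,
given the Arnoldi vectors `v` and the unpreconditioned Arnoldi vectors `vt`. -/
def arnoldiW {N : ℕ} (B P : Matrix (Fin N) (Fin N) ℝ) (kmax : ℕ) (v vt : ℕ → Fin N → ℝ)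
    (k : ℕ) : ℕ → (Fin N → ℝ) × (Fin N → ℝ)
  | 0 => (B *ᵥ v k, P *ᵥ (B *ᵥ v k))
  | j + 1 =>
    let w := arnoldiW B P kmax v vt k j
    let i := gmresStart kmax k + (j + 1)
    (w.1 - (w.1 ⬝ᵥ v i) • vt i, w.2 - (w.1 ⬝ᵥ v i) • v i)

/-- `H_{K+1,K}`, computed in step `k`. -/
def arnoldiSub {N : ℕ} (B P : Matrix (Fin N) (Fin N) ℝ) (kmax : ℕ) (v vt : ℕ → Fin N → ℝ)
    (k : ℕ) : ℝ :=
  let w := arnoldiW B P kmax v vt k (gmresK kmax k)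
  √(w.1 ⬝ᵥ w.2)

/-- The entry `H_{iK}`, computed in step `k`, for `1 ≤ i ≤ K + 1` (and zero for `i > K + 1`). -/
def arnoldiEntry {N : ℕ} (B P : Matrix (Fin N) (Fin N) ℝ) (kmax : ℕ) (v vt : ℕ → Fin N → ℝ)
    (k i : ℕ) : ℝ :=
  if i ≤ gmresK kmax k then
    (arnoldiW B P kmax v vt k (i - 1)).1 ⬝ᵥ v (gmresStart kmax k + i)
  else if i = gmresK kmax k + 1 then arnoldiSub B P kmax v vt k
  else 0

/-- The Hessenberg matrix `H_{[1:K+1,1:K]}` available in step `k`; its `j`-th column was computed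
in the `j`-th step after the last restart. Indices are shifted since `Fin` starts at `0`. -/
def hessenberg {N : ℕ} (B P : Matrix (Fin N) (Fin N) ℝ) (kmax : ℕ) (v vt : ℕ → Fin N → ℝ)
    (k : ℕ) : Matrix (Fin (gmresK kmax k + 1)) (Fin (gmresK kmax k)) ℝ :=
  fun i j => arnoldiEntry B P kmax v vt (gmresStart kmax k + (j + 1)) (i + 1)

/-- Initialization of GMRES for `B x = r` with preconditioner `P`. -/
structure IsGMRESInit {N : ℕ} (B P : Matrix (Fin N) (Fin N) ℝ) (r : Fin N → ℝ)
    (x v vt : ℕ → Fin N → ℝ) : Prop where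
  vt_one : vt 1 = (precNorm P (P *ᵥ (r - B *ᵥ x 0)))⁻¹ • (r - B *ᵥ x 0)
  v_one : v 1 = P *ᵥ vt 1

/-- Step `k ≥ 1` of the preconditioned GMRES method with restart length `kmax` for `B x = r`:
minimization of the projected residual, update of the iterate, and computation of the next
Arnoldi vectors. -/
structure IsGMRESStep {N : ℕ} (B P : Matrix (Fin N) (Fin N) ℝ) (r : Fin N → ℝ) (kmax : ℕ)
    (x v vt : ℕ → Fin N → ℝ) (k : ℕ) : Prop where
  iterate : ∃ y : Fin (gmresK kmax k) → ℝ,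
    (∀ z : Fin (gmresK kmax k) → ℝ,
      ‖WithLp.toLp 2 (Pi.single 0 (precNorm P (P *ᵥ (r - B *ᵥ x (gmresStart kmax k)))) -
          hessenberg B P kmax v vt k *ᵥ y)‖ ≤
        ‖WithLp.toLp 2 (Pi.single 0 (precNorm P (P *ᵥ (r - B *ᵥ x (gmresStart kmax k)))) -
          hessenberg B P kmax v vt k *ᵥ z)‖) ∧
    x k = x (gmresStart kmax k) + ∑ j, y j • v (gmresStart kmax k + (j + 1))
  vt_succ : vt (k + 1) =
    if k % kmax = 0 then (precNorm P (P *ᵥ (r - B *ᵥ x k)))⁻¹ • (r - B *ᵥ x k)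
    else (arnoldiSub B P kmax v vt k)⁻¹ • (arnoldiW B P kmax v vt k (gmresK kmax k)).1
  v_succ : v (k + 1) =
    if k % kmax = 0 then (precNorm P (P *ᵥ (r - B *ᵥ x k)))⁻¹ • (P *ᵥ (r - B *ᵥ x k))
    else (arnoldiSub B P kmax v vt k)⁻¹ • (arnoldiW B P kmax v vt k (gmresK kmax k)).2

/-! ### The adaptive algorithm -/

/-- The quantities occurring in the adaptive algorithm: on level `ℓ`, the mesh, a basis of the
finite element space, the preconditioner, the coefficient vectors of the iterates, the Arnoldi
vectors, the marked elements, and the values of `C_alg`, `λ_alg` and `S` at the beginning of the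
level. -/
structure Iteration {d : ℕ} (D : Problem d) (p : ℕ) where
  mesh : ℕ → Mesh d
  N : ℕ → ℕ
  basis : ∀ ℓ, Module.Basis (Fin (N ℓ)) ℝ (feSpace D.Ω p (mesh ℓ))
  P : ∀ ℓ, Matrix (Fin (N ℓ)) (Fin (N ℓ)) ℝ
  x : ∀ ℓ, ℕ → Fin (N ℓ) → ℝ
  v : ∀ ℓ, ℕ → Fin (N ℓ) → ℝ
  vt : ∀ ℓ, ℕ → Fin (N ℓ) → ℝ
  marked : ℕ → Mesh d
  Calg : ℕ → ℝ
  lam : ℕ → ℝ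
  S : ℕ → ℝ≥0∞

namespace Iteration

variable {d : ℕ} {D : Problem d} {p : ℕ} (R : Iteration D p)

/-- The finite element function with coefficient vector `y` on level `ℓ`. -/
def fn (ℓ : ℕ) (y : Fin (R.N ℓ) → ℝ) : H10 D.Ω := ∑ j, y j • (R.basis ℓ j : H10 D.Ω)

/-- The iterate `u_ℓ^k`. -/
def u (ℓ k : ℕ) : H10 D.Ω := R.fn ℓ (R.x ℓ k)

/-- The Galerkin matrix. -/
def B (ℓ : ℕ) : Matrix (Fin (R.N ℓ)) (Fin (R.N ℓ)) ℝ :=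
  fun j k => D.form (R.basis ℓ k) (R.basis ℓ j)

/-- The Galerkin right-hand side. -/
def load (ℓ : ℕ) : Fin (R.N ℓ) → ℝ := fun j => D.rhs (R.basis ℓ j)

/-- The norm `‖s_ℓ^k‖_{P⁻¹}` of the preconditioned residual. -/
def resNorm (ℓ k : ℕ) : ℝ :=
  precNorm (R.P ℓ) (R.P ℓ *ᵥ (R.load ℓ - R.B ℓ *ᵥ R.x ℓ k))

/-- The computable quasi-error `H_ℓ^k`. -/
def quasiError (ℓ k : ℕ) : ℝ := D.eta (R.mesh ℓ) (R.mesh ℓ) (R.u ℓ k) + R.resNorm ℓ k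

/-- The solver stopping criterion for `u_ℓ^k`. -/
def Stops (ℓ k : ℕ) : Prop :=
  R.resNorm ℓ k ≤ R.lam ℓ * D.eta (R.mesh ℓ) (R.mesh ℓ) (R.u ℓ k)

/-- `u_ℓ^k` is the final iterate on level `ℓ`, i.e. `k` is the least index `≥ 1` for which the
stopping criterion holds. -/
def IsFinal (ℓ k : ℕ) : Prop :=
  1 ≤ k ∧ R.Stops ℓ k ∧ ∀ j, 1 ≤ j → j < k → ¬ R.Stops ℓ j

/-- Level `ℓ` is reached: the solver terminates on all previous levels. -/
def Reached (ℓ : ℕ) : Prop := ∀ ℓ' < ℓ, ∃ k, R.IsFinal ℓ' k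

/-- The index set of all `(ℓ, k)` such that `u_ℓ^k` appears in the algorithm. -/
def Q : Set (ℕ × ℕ) := {q | R.Reached q.1 ∧ ∀ j, 1 ≤ j → j < q.2 → ¬ R.Stops q.1 j}

/-- The total step counter `|ℓ, k|` with respect to the lexicographic order. -/
def steps (q : ℕ × ℕ) : ℕ := {q' ∈ R.Q | q'.1 < q.1 ∨ q'.1 = q.1 ∧ q'.2 ≤ q.2}.ncard

/-- The preconditioners are symmetric positive definite and the induced norms are uniformly
equivalent to the energy norm. -/
def OptimalPreconditioner : Prop :=
  ∃ Cpre : ℝ, 1 ≤ Cpre ∧ ∀ ℓ, R.Reached ℓ → (R.P ℓ).PosDef ∧ ∀ y : Fin (R.N ℓ) → ℝ,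
    Cpre⁻¹ * D.enorm (R.fn ℓ y) ≤ precNorm (R.P ℓ) y ∧
      precNorm (R.P ℓ) y ≤ Cpre * D.enorm (R.fn ℓ y)

/-- `R` is generated by the adaptive algorithm without termination by a tolerance, for the
initial mesh `𝒯₀`, initial guess `u₀`, marking parameters `θ` and `Cmark`, restart length `kmax`,
and initial parameters `Calg₀` and `lam₀`. The reciprocals in the parameter control are extended
real numbers, `1 / 0 = ∞`. -/
structure IsGenerated (𝒯₀ : Mesh d) (θ Cmark Calg₀ lam₀ : ℝ) (kmax : ℕ) (u₀ : H10 D.Ω) :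
    Prop where
  mesh_zero : R.mesh 0 = 𝒯₀
  u_zero : R.u 0 0 = u₀
  Calg_zero : R.Calg 0 = Calg₀
  lam_zero : R.lam 0 = lam₀
  S_zero : R.S 0 = 0
  /-- Solve & Estimate. -/
  solve_init : ∀ ℓ, R.Reached ℓ →
    IsGMRESInit (R.B ℓ) (R.P ℓ) (R.load ℓ) (R.x ℓ) (R.v ℓ) (R.vt ℓ)
  solve_step : ∀ ℓ k, (ℓ, k) ∈ R.Q → 1 ≤ k →
    IsGMRESStep (R.B ℓ) (R.P ℓ) (R.load ℓ) kmax (R.x ℓ) (R.v ℓ) (R.vt ℓ) k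
  /-- Adaptive Parameter Control: the parameters are updated. -/
  control_update : ∀ ℓ k, R.Reached ℓ → R.IsFinal ℓ k →
    (1 ≤ ℓ ∧ ENNReal.ofReal (R.Calg ℓ) * (ENNReal.ofReal (R.quasiError ℓ k))⁻¹ < R.S ℓ) →
      R.Calg (ℓ + 1) = 2 * R.Calg ℓ ∧ R.lam (ℓ + 1) = R.lam ℓ / 2
  /-- Adaptive Parameter Control: the parameters are kept. -/
  control_keep : ∀ ℓ k, R.Reached ℓ → R.IsFinal ℓ k →
    ¬ (1 ≤ ℓ ∧ ENNReal.ofReal (R.Calg ℓ) * (ENNReal.ofReal (R.quasiError ℓ k))⁻¹ < R.S ℓ) →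
      R.Calg (ℓ + 1) = R.Calg ℓ ∧ R.lam (ℓ + 1) = R.lam ℓ
  control_S : ∀ ℓ k, R.Reached ℓ → R.IsFinal ℓ k →
    R.S (ℓ + 1) = R.S ℓ + (ENNReal.ofReal (R.quasiError ℓ k))⁻¹
  /-- Mark: Dörfler criterion. -/
  mark_subset : ∀ ℓ k, R.Reached ℓ → R.IsFinal ℓ k → R.marked ℓ ⊆ R.mesh ℓ
  mark_doerfler : ∀ ℓ k, R.Reached ℓ → R.IsFinal ℓ k →
    θ * D.eta (R.mesh ℓ) (R.mesh ℓ) (R.u ℓ k) ^ 2 ≤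
      D.eta (R.mesh ℓ) (R.marked ℓ) (R.u ℓ k) ^ 2
  /-- Mark: minimal cardinality up to the factor `Cmark`. -/
  mark_card : ∀ ℓ k, R.Reached ℓ → R.IsFinal ℓ k → ∀ 𝒰 ⊆ R.mesh ℓ,
    θ * D.eta (R.mesh ℓ) (R.mesh ℓ) (R.u ℓ k) ^ 2 ≤ D.eta (R.mesh ℓ) 𝒰 (R.u ℓ k) ^ 2 →
      ((R.marked ℓ).card : ℝ) ≤ Cmark * (𝒰.card : ℝ)
  /-- Refine. -/
  refine_mesh : ∀ ℓ k, R.Reached ℓ → R.IsFinal ℓ k →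
    IsRefine 𝒯₀ (R.mesh ℓ) (R.marked ℓ) (R.mesh (ℓ + 1))
  /-- Nested iteration. -/
  nested : ∀ ℓ k, R.Reached ℓ → R.IsFinal ℓ k → R.u (ℓ + 1) 0 = R.u ℓ k

end Iteration

end AFEM

end

/-! The statement is plain convergence, so no quasi-orthogonality or rate argument is needed. It
suffices that for each ε only finitely many indices of `Q` have total error at least ε
(`tendsto_steps_of_finite`). By reliability and stability the total error is bounded by the
algebraic error plus the computable estimator, and the algebraic error is equivalent to the
preconditioned residual.

Solver: coercivity and boundedness of the form, together with the preconditioner assumption, make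
the preconditioned operator uniformly coercive and bounded in the `P⁻¹` inner product. One explicit
residual correction then contracts the residual. GMRES minimizes over a space that contains this
correction from the last restart (`gmres_residual_le`), so every restart cycle gains a uniform
factor q < 1.

If the solver fails to stop on some level, the residual tends to zero there, and the violated
stopping criterion forces the estimator to zero as well (`tendsto_totalError`); only finitely many
indices precede that level.

Otherwise all levels are reached. The errors of all iterates on level ℓ+1 are bounded by a multiple
of the final quasi-error `H_ℓ` (`exists_totalError_succ_le`), so `H_ℓ → 0` has to be shown
(`tendsto_quasiError`). The parameter control yields a dichotomy. With infinitely many updates, λ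
tends to zero; estimator reduction is then a contraction perturbed by small multiples of the
estimator and by increments of the Galerkin solutions, which vanish since Galerkin solutions in
nested spaces converge. With finitely many updates, the sum of the reciprocals of the previous
quasi-errors stays below a fixed multiple of the current reciprocal; this sum grows at least
linearly, hence `H_ℓ → 0` again. -/

namespace AFEM

/-! ### Bilinear forms on `L²(Ω) × L²(Ω; ℝᵈ)` -/

/-- Hölder with exponents ∞, 2, 2 makes multiplication by m bounded on L². Integrability is recorded
too, since splitting Bochner integrals requires it. -/
lemma exists_weightedPairing {α : Type*} [MeasurableSpace α] {μ : Measure α} {m : α → ℝ}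
    (hm : MemLp m ∞ μ) :
    ∃ S : Lp ℝ 2 μ →L[ℝ] Lp ℝ 2 μ →L[ℝ] ℝ, ∀ f g : Lp ℝ 2 μ,
      Integrable (fun x => m x * f x * g x) μ ∧ S f g = ∫ x, m x * f x * g x ∂μ := by
  set M : Lp ℝ ∞ μ := hm.toLp m with hM
  set B : ℝ →L[ℝ] ℝ →L[ℝ] ℝ := ContinuousLinearMap.mul ℝ ℝ
  set T : Lp ℝ 2 μ →L[ℝ] Lp ℝ 2 μ := B.holderL μ ∞ 2 2 M with hT
  have hTf : ∀ f : Lp ℝ 2 μ, T f =ᵐ[μ] fun x => m x * f x := by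
    intro f
    have h1 := B.coeFn_holder (r := 2) M f
    filter_upwards [h1, hm.coeFn_toLp] with x hx hx'
    have : (T f) x = (B.holder 2 M f) x := by simp [hT]
    rw [this, hx, hx']
    rfl
  refine ⟨(B.lpPairing μ 2 2).comp T, fun f g => ?_⟩
  have hae : (fun x => T f x * g x) =ᵐ[μ] fun x => m x * f x * g x := by
    filter_upwards [hTf f] with x hx
    rw [hx]
  refine ⟨?_, ?_⟩
  · exact ((Lp.memLp (T f)).integrable_mul (Lp.memLp g)).congr hae
  · rw [ContinuousLinearMap.comp_apply, ContinuousLinearMap.lpPairing_eq_integral,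
      ← integral_congr_ae hae]
    rfl

/-- The `i`-th component of the second entry of a pair. -/
noncomputable def gradCoord {d : ℕ} (Ω : Set (E d)) (i : Fin d) :
    L2Pair Ω →L[ℝ] Lp ℝ 2 (volume.restrict Ω) :=
  ((EuclideanSpace.proj i : E d →L[ℝ] ℝ).compLpL 2 (volume.restrict Ω)).comp
    (WithLp.sndL 2 ℝ _ _)

lemma gradCoord_coeFn {d : ℕ} {Ω : Set (E d)} (i : Fin d) (w : L2Pair Ω) :
    gradCoord Ω i w =ᵐ[volume.restrict Ω] fun x => w.snd x i :=
  ContinuousLinearMap.coeFn_compLpL _ _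

lemma inner_toEuclideanLin {d : ℕ} (A : Matrix (Fin d) (Fin d) ℝ) (ξ ζ : E d) :
    ⟪A.toEuclideanLin ξ, ζ⟫ = ∑ i, ∑ j, A i j * ξ j * ζ i := by
  simp [PiLp.inner_apply, Matrix.toLpLin_apply, mulVec, dotProduct, Finset.mul_sum, mul_comm]

/-- In coordinates the integrand is a finite sum of weighted products of partial derivatives, each
of which is a bounded pairing. -/
lemma exists_principalForm {d : ℕ} {Ω : Set (E d)} {K : E d → Matrix (Fin d) (Fin d) ℝ}
    (hK : ∀ i j, MemLp (fun x => K x i j) ∞ (volume.restrict Ω)) :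
    ∃ A : L2Pair Ω →L[ℝ] L2Pair Ω →L[ℝ] ℝ, ∀ v w : L2Pair Ω,
      Integrable (fun x => ⟪(K x).toEuclideanLin (v.snd x), w.snd x⟫) (volume.restrict Ω) ∧
      A v w = ∫ x in Ω, ⟪(K x).toEuclideanLin (v.snd x), w.snd x⟫ := by
  choose S hS using fun i j => exists_weightedPairing (hK i j)
  refine ⟨∑ i, ∑ j, (S i j).bilinearComp (gradCoord Ω j) (gradCoord Ω i), fun v w => ?_⟩
  have hae : (fun x => ∑ i, ∑ j, K x i j * gradCoord Ω j v x * gradCoord Ω i w x)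
      =ᵐ[volume.restrict Ω] fun x => ⟪(K x).toEuclideanLin (v.snd x), w.snd x⟫ := by
    have h1 := ae_all_iff.2 fun i => gradCoord_coeFn i v
    have h2 := ae_all_iff.2 fun i => gradCoord_coeFn i w
    filter_upwards [h1, h2] with x hx hx'
    simp only [inner_toEuclideanLin, hx, hx']
  have hint : ∀ i j, Integrable (fun x => K x i j * gradCoord Ω j v x * gradCoord Ω i w x)
    (volume.restrict Ω) := fun i j => (hS i j _ _).1
  refine ⟨(integrable_finsetSum _ fun i _ => integrable_finsetSum _ fun j _ =>
    hint i j).congr hae, ?_⟩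
  rw [← integral_congr_ae hae,
    integral_finsetSum _ fun i _ => integrable_finsetSum _ fun j _ => hint i j]
  simp only [_root_.sum_apply, ContinuousLinearMap.bilinearComp_apply]
  refine Finset.sum_congr rfl fun i _ => ?_
  rw [integral_finsetSum _ fun j _ => hint i j]
  exact Finset.sum_congr rfl fun j _ => (hS i j _ _).2

lemma exists_convectionForm {d : ℕ} {Ω : Set (E d)} {b : E d → E d}
    (hb : MemLp b ∞ (volume.restrict Ω)) :
    ∃ A : L2Pair Ω →L[ℝ] L2Pair Ω →L[ℝ] ℝ, ∀ v w : L2Pair Ω,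
      Integrable (fun x => ⟪b x, v.snd x⟫ * w.fst x) (volume.restrict Ω) ∧
      A v w = ∫ x in Ω, ⟪b x, v.snd x⟫ * w.fst x := by
  have hbi : ∀ i, MemLp (fun x => b x i) ∞ (volume.restrict Ω) := fun i =>
    (EuclideanSpace.proj i : E d →L[ℝ] ℝ).comp_memLp' hb
  choose S hS using fun i => exists_weightedPairing (hbi i)
  refine ⟨∑ i, (S i).bilinearComp (gradCoord Ω i) (WithLp.fstL 2 ℝ _ _), fun v w => ?_⟩
  have hae : (fun x => ∑ i, b x i * gradCoord Ω i v x * w.fst x)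
      =ᵐ[volume.restrict Ω] fun x => ⟪b x, v.snd x⟫ * w.fst x := by
    have h1 := ae_all_iff.2 fun i => gradCoord_coeFn i v
    filter_upwards [h1] with x hx
    simp only [hx, PiLp.inner_apply, Finset.sum_mul]
    exact Finset.sum_congr rfl fun i _ => by simp [mul_comm]
  have hint : ∀ i, Integrable (fun x => b x i * gradCoord Ω i v x * w.fst x)
    (volume.restrict Ω) := fun i => (hS i _ _).1
  refine ⟨(integrable_finsetSum _ fun i _ => hint i).congr hae, ?_⟩
  rw [← integral_congr_ae hae, integral_finsetSum _ fun i _ => hint i]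
  simp only [_root_.sum_apply, ContinuousLinearMap.bilinearComp_apply]
  exact Finset.sum_congr rfl fun i _ => (hS i _ _).2

lemma exists_reactionForm {d : ℕ} {Ω : Set (E d)} {c : E d → ℝ}
    (hc : MemLp c ∞ (volume.restrict Ω)) :
    ∃ A : L2Pair Ω →L[ℝ] L2Pair Ω →L[ℝ] ℝ, ∀ v w : L2Pair Ω,
      Integrable (fun x => c x * v.fst x * w.fst x) (volume.restrict Ω) ∧
      A v w = ∫ x in Ω, c x * v.fst x * w.fst x := by
  obtain ⟨S, hS⟩ := exists_weightedPairing hc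
  exact ⟨S.bilinearComp (WithLp.fstL 2 ℝ _ _) (WithLp.fstL 2 ℝ _ _), fun v w => hS _ _⟩

/-! ### Test functions and density arguments -/

lemma IsTest.add {d : ℕ} {U : Set (E d)} {φ ψ : E d → ℝ} (hφ : IsTest U φ) (hψ : IsTest U ψ) :
    IsTest U (φ + ψ) :=
  ⟨hφ.1.add hψ.1, hφ.2.1.add hψ.2.1,
    (tsupport_add φ ψ).trans (Set.union_subset hφ.2.2 hψ.2.2)⟩

lemma IsTest.const_smul {d : ℕ} {U : Set (E d)} {φ : E d → ℝ} (r : ℝ) (hφ : IsTest U φ) :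
    IsTest U (r • φ) :=
  ⟨hφ.1.const_smul r, hφ.2.1.smul_left (f := fun _ => r),
    (tsupport_smul_subset_right (fun _ => r) φ).trans hφ.2.2⟩

lemma IsTest.mul_self {d : ℕ} {U : Set (E d)} {φ : E d → ℝ} (hφ : IsTest U φ) :
    IsTest U (φ * φ) :=
  ⟨hφ.1.mul hφ.1, hφ.2.1.mul_left, tsupport_mul_subset_left.trans hφ.2.2⟩

lemma IsTest.zero {d : ℕ} (U : Set (E d)) : IsTest U (0 : E d → ℝ) := by
  refine ⟨contDiff_const, HasCompactSupport.zero, ?_⟩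
  rw [tsupport_eq_empty_iff.2 rfl]
  exact Set.empty_subset _

lemma IsTest.differentiable {d : ℕ} {U : Set (E d)} {φ : E d → ℝ} (hφ : IsTest U φ) :
    Differentiable ℝ φ := hφ.1.differentiable (by simp)

lemma gradient_add_of_differentiable {d : ℕ} {φ ψ : E d → ℝ} (hφ : Differentiable ℝ φ)
    (hψ : Differentiable ℝ ψ) : gradient (φ + ψ) = gradient φ + gradient ψ := by
  funext x
  simp [gradient, fderiv_add (hφ x) (hψ x)]

lemma gradient_const_smul_of_differentiable {d : ℕ} {φ : E d → ℝ} (r : ℝ)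
    (hφ : Differentiable ℝ φ) : gradient (r • φ) = r • gradient φ := by
  funext x
  simp [gradient, fderiv_const_smul (hφ x) r]

lemma gradient_mul_self_of_differentiable {d : ℕ} {φ : E d → ℝ} (hφ : Differentiable ℝ φ)
    (x : E d) : gradient (φ * φ) x = (2 * φ x) • gradient φ x := by
  simp only [gradient, fderiv_mul (hφ x) (hφ x), map_add, map_smul, two_mul, add_smul]

lemma fderiv_single_eq_gradient {d : ℕ} (φ : E d → ℝ) (x : E d) (i : Fin d) :
    fderiv ℝ φ x (EuclideanSpace.single i 1) = gradient φ x i := by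
  have h : ⟪gradient φ x, EuclideanSpace.single i 1⟫ = fderiv ℝ φ x (EuclideanSpace.single i 1) := by
    simp [gradient]
  rw [← h, EuclideanSpace.inner_single_right]
  simp

/-- A closed property of pairs that holds for all `(φ, ∇φ)`, `φ ∈ C_c^∞(Ω)`, holds on `H¹₀(Ω)`. -/
lemma h10_induction {d : ℕ} {Ω : Set (E d)} {Pr : L2Pair Ω → Prop}
    (hcl : IsClosed {w | Pr w})
    (htest : ∀ φ, IsTest Ω φ → ∀ w : L2Pair Ω, w.fst =ᵐ[volume.restrict Ω] φ →
      w.snd =ᵐ[volume.restrict Ω] gradient φ → Pr w)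
    {v : L2Pair Ω} (hv : v ∈ h10 Ω) : Pr v := by
  -- The pairs (φ, ∇φ) already form a subspace, so taking the span adds nothing.
  have hspan : ∀ w ∈ Submodule.span ℝ {w : L2Pair Ω | ∃ φ, IsTest Ω φ ∧
      w.fst =ᵐ[volume.restrict Ω] φ ∧ w.snd =ᵐ[volume.restrict Ω] gradient φ},
      ∃ φ, IsTest Ω φ ∧ w.fst =ᵐ[volume.restrict Ω] φ ∧
        w.snd =ᵐ[volume.restrict Ω] gradient φ := by
    intro w hw
    induction hw using Submodule.span_induction with
    | mem x hx => exact hx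
    | zero =>
      refine ⟨0, IsTest.zero Ω, Lp.coeFn_zero _ _ _, ?_⟩
      have : gradient (0 : E d → ℝ) = 0 := by
        funext x
        simp [gradient]
      rw [this]
      exact Lp.coeFn_zero _ _ _
    | add x y _ _ hx hy =>
      obtain ⟨φ, hφ, h1, h2⟩ := hx
      obtain ⟨ψ, hψ, h3, h4⟩ := hy
      refine ⟨φ + ψ, hφ.add hψ, (Lp.coeFn_add _ _).trans (h1.add h3), ?_⟩
      rw [gradient_add_of_differentiable hφ.differentiable hψ.differentiable]
      exact (Lp.coeFn_add _ _).trans (h2.add h4)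
    | smul r x _ hx =>
      obtain ⟨φ, hφ, h1, h2⟩ := hx
      refine ⟨r • φ, hφ.const_smul r, (Lp.coeFn_smul _ _).trans (h1.const_smul r), ?_⟩
      rw [gradient_const_smul_of_differentiable r hφ.differentiable]
      exact (Lp.coeFn_smul _ _).trans (h2.const_smul r)
  refine Set.mem_of_subset_of_mem (closure_minimal ?_ hcl) hv
  intro w hw
  obtain ⟨φ, hφ, h1, h2⟩ := hspan w hw
  exact htest φ hφ w h1 h2

/-! ### Friedrichs' inequality and the sign of the lower-order terms. -/

lemma IsTest.gradient_eq_zero {d : ℕ} {U : Set (E d)} {φ : E d → ℝ} (hφ : IsTest U φ) {x : E d}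
    (hx : x ∉ U) : gradient φ x = 0 := by
  have : fderiv ℝ φ x = 0 := by
    by_contra h
    exact hx (hφ.2.2 (support_fderiv_subset ℝ h))
  simp [gradient, this]

lemma IsTest.continuous_gradient {d : ℕ} {U : Set (E d)} {φ : E d → ℝ} (hφ : IsTest U φ) :
    Continuous (gradient φ) :=
  (InnerProductSpace.toDual ℝ (E d)).symm.continuous.comp (hφ.1.continuous_fderiv (by simp))

lemma IsTest.hasCompactSupport_gradient {d : ℕ} {U : Set (E d)} {φ : E d → ℝ}
    (hφ : IsTest U φ) : HasCompactSupport (gradient φ) :=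
  (hφ.2.1.fderiv (𝕜 := ℝ)).comp_left (g := (InnerProductSpace.toDual ℝ (E d)).symm) (map_zero _)

lemma IsTest.integrable_sq {d : ℕ} {U : Set (E d)} {φ : E d → ℝ} (hφ : IsTest U φ) :
    Integrable fun x => φ x ^ 2 := by
  have hc : HasCompactSupport fun x => φ x * φ x := HasCompactSupport.mul_right hφ.2.1
  have hcont : Continuous fun x => φ x * φ x := hφ.1.continuous.mul hφ.1.continuous
  simpa only [pow_two] using hcont.integrable_of_hasCompactSupport hc

lemma IsTest.integrable_norm_gradient_sq {d : ℕ} {U : Set (E d)} {φ : E d → ℝ}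
    (hφ : IsTest U φ) : Integrable fun x => ‖gradient φ x‖ ^ 2 := by
  have hn : HasCompactSupport fun x => ‖gradient φ x‖ := hφ.hasCompactSupport_gradient.norm
  have hc : HasCompactSupport fun x => ‖gradient φ x‖ * ‖gradient φ x‖ :=
    HasCompactSupport.mul_right hn
  have hcont : Continuous fun x => ‖gradient φ x‖ * ‖gradient φ x‖ :=
    hφ.continuous_gradient.norm.mul hφ.continuous_gradient.norm
  simpa only [pow_two] using hcont.integrable_of_hasCompactSupport hc

lemma continuous_coord {d : ℕ} (i : Fin d) : Continuous fun x : E d => x i :=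
  (EuclideanSpace.proj i : E d →L[ℝ] ℝ).continuous

lemma IsTest.integrable_mul_gradient_mul {d : ℕ} {U : Set (E d)} {φ : E d → ℝ}
    (hφ : IsTest U φ) (i : Fin d) :
    Integrable fun x => 2 * φ x * gradient φ x i * x i := by
  have hc : HasCompactSupport fun x => 2 * φ x * gradient φ x i * x i := by
    have h : HasCompactSupport fun x => 2 * φ x :=
      HasCompactSupport.mul_left (f := fun _ => (2 : ℝ)) hφ.2.1
    have h' : HasCompactSupport fun x => 2 * φ x * gradient φ x i := HasCompactSupport.mul_right h
    exact HasCompactSupport.mul_right h'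
  refine Continuous.integrable_of_hasCompactSupport ?_ hc
  exact ((continuous_const.mul hφ.1.continuous).mul
    ((continuous_coord i).comp hφ.continuous_gradient)).mul (continuous_coord i)

lemma fderiv_coord_single {d : ℕ} (i : Fin d) (x : E d) :
    fderiv ℝ (fun y : E d => y i) x (EuclideanSpace.single i 1) = 1 := by
  have : (fun y : E d => y i) = (EuclideanSpace.proj i : E d →L[ℝ] ℝ) := rfl
  rw [this, ContinuousLinearMap.fderiv]
  simp

/-- Integration by parts of φ² against the coordinate function, whose derivative in its own
direction is 1. -/
lemma IsTest.integral_sq {d : ℕ} {U : Set (E d)} {φ : E d → ℝ} (hφ : IsTest U φ) (i : Fin d) :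
    ∫ x, φ x ^ 2 = -∫ x, 2 * φ x * gradient φ x i * x i := by
  have hfd : ∀ x, fderiv ℝ (fun y => φ y * φ y) x (EuclideanSpace.single i 1)
      = 2 * φ x * gradient φ x i := by
    intro x
    have := fderiv_single_eq_gradient (φ * φ) x i
    rw [gradient_mul_self_of_differentiable hφ.differentiable] at this
    exact this
  have hc : HasCompactSupport fun x => φ x * φ x * x i := by
    have h : HasCompactSupport fun x => φ x * φ x := HasCompactSupport.mul_right hφ.2.1
    exact HasCompactSupport.mul_right h
  have hint : Integrable fun x => φ x * φ x * x i :=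
    ((hφ.1.continuous.mul hφ.1.continuous).mul
      (continuous_coord i)).integrable_of_hasCompactSupport hc
  have h := integral_mul_fderiv_eq_neg_fderiv_mul_of_integrable (μ := volume)
    (v := (EuclideanSpace.single i 1 : E d)) (f := fun y => φ y * φ y) (g := fun y : E d => y i)
    (by simpa only [hfd] using hφ.integrable_mul_gradient_mul i)
    (by simpa only [fderiv_coord_single, mul_one, ← pow_two] using hφ.integrable_sq) hint
    (fun x _ => (hφ.differentiable x).mul (hφ.differentiable x))
    (fun x _ => (EuclideanSpace.proj i : E d →L[ℝ] ℝ).differentiableAt)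
  simp only [hfd, fderiv_coord_single, mul_one] at h
  simpa only [pow_two] using h

/-- Friedrichs' inequality for test functions. -/
lemma IsTest.friedrichs {d : ℕ} (hd : 1 ≤ d) {Ω : Set (E d)} {R : ℝ}
    (hΩ : ∀ x ∈ Ω, ‖x‖ ≤ R) {φ : E d → ℝ} (hφ : IsTest Ω φ) :
    ∫ x in Ω, φ x ^ 2 ≤ 4 * R ^ 2 * ∫ x in Ω, ‖gradient φ x‖ ^ 2 := by
  have hzero : ∀ x, x ∉ Ω → φ x = 0 := fun x hx =>
    image_eq_zero_of_notMem_tsupport fun h => hx (hφ.2.2 h)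
  rw [setIntegral_eq_integral_of_forall_compl_eq_zero (fun x hx => by rw [hzero x hx]; simp),
    setIntegral_eq_integral_of_forall_compl_eq_zero
      (fun x hx => by rw [hφ.gradient_eq_zero hx]; simp)]
  have hi1 := hφ.integrable_sq
  have hi2 := hφ.integrable_norm_gradient_sq
  set i : Fin d := ⟨0, hd⟩
  -- Young's inequality, in the form (φ + 2 x_i ∂_iφ)² ≥ 0: half of ∫ φ² appears on the right and is
  -- absorbed at the end.
  have hle : -∫ x, 2 * φ x * gradient φ x i * x i
      ≤ ∫ x, ((1 / 2) * φ x ^ 2 + 2 * R ^ 2 * ‖gradient φ x‖ ^ 2) := by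
    rw [← integral_neg]
    refine integral_mono (hφ.integrable_mul_gradient_mul i).fun_neg
      ((hi1.const_mul _).add (hi2.const_mul _)) fun x => ?_
    dsimp only
    by_cases hx : x ∈ Ω
    · have h1 : |gradient φ x i| ≤ ‖gradient φ x‖ := PiLp.norm_apply_le (gradient φ x) i
      have h2 : |x i| ≤ R := (PiLp.norm_apply_le x i : |x i| ≤ ‖x‖).trans (hΩ x hx)
      have h3 : |gradient φ x i * x i| ≤ ‖gradient φ x‖ * R := by
        rw [abs_mul]
        exact mul_le_mul h1 h2 (abs_nonneg _) (norm_nonneg _)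
      have h4 : (gradient φ x i * x i) ^ 2 ≤ (‖gradient φ x‖ * R) ^ 2 :=
        sq_le_sq' (neg_le_of_abs_le h3) (le_of_abs_le h3)
      generalize gradient φ x i = s at *
      generalize x i = t at *
      generalize ‖gradient φ x‖ = n at *
      generalize φ x = y at *
      linarith [sq_nonneg (y + 2 * (s * t)), mul_pow n R 2]
    · rw [hzero x hx]
      have := mul_nonneg (mul_nonneg (by norm_num : (0 : ℝ) ≤ 2) (sq_nonneg R))
        (sq_nonneg ‖gradient φ x‖)
      simpa using this
  rw [← hφ.integral_sq i, integral_add (hi1.const_mul _) (hi2.const_mul _), integral_const_mul,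
    integral_const_mul] at hle
  linarith

lemma norm_sq_eq_setIntegral {α F : Type*} [MeasurableSpace α] {μ : Measure α}
    [NormedAddCommGroup F] [InnerProductSpace ℝ F] (f : Lp F 2 μ) :
    ‖f‖ ^ 2 = ∫ x, ‖f x‖ ^ 2 ∂μ := by
  rw [← real_inner_self_eq_norm_sq, L2.inner_def]
  simp only [real_inner_self_eq_norm_sq]

/-- Friedrichs' inequality in `H¹₀(Ω)`. -/
lemma h10_friedrichs {d : ℕ} (hd : 1 ≤ d) {Ω : Set (E d)} {R : ℝ} (hR : 0 ≤ R)
    (hΩ : ∀ x ∈ Ω, ‖x‖ ≤ R) {v : L2Pair Ω} (hv : v ∈ h10 Ω) :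
    ‖v.fst‖ ≤ 2 * R * ‖v.snd‖ := by
  refine h10_induction (Pr := fun v => ‖v.fst‖ ≤ 2 * R * ‖v.snd‖) ?_ ?_ hv
  · exact isClosed_le (WithLp.fstL 2 ℝ _ _).continuous.norm
      (continuous_const.mul (WithLp.sndL 2 ℝ _ _).continuous.norm)
  · intro φ hφ w h1 h2
    have h3 : ‖w.fst‖ ^ 2 = ∫ x in Ω, φ x ^ 2 := by
      rw [norm_sq_eq_setIntegral]
      refine integral_congr_ae ?_
      filter_upwards [h1] with x hx
      rw [hx]; simp
    have h4 : ‖w.snd‖ ^ 2 = ∫ x in Ω, ‖gradient φ x‖ ^ 2 := by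
      rw [norm_sq_eq_setIntegral]
      refine integral_congr_ae ?_
      filter_upwards [h2] with x hx
      rw [hx]
    have h5 := hφ.friedrichs hd hΩ
    rw [← h3, ← h4] at h5
    refine le_of_sq_le_sq ?_ (by positivity)
    nlinarith

/-- The lower-order terms are nonnegative on the diagonal. -/
lemma h10_lowerOrder_nonneg {d : ℕ} {Ω : Set (E d)} {b : E d → E d} {c δ : E d → ℝ}
    (hb : MemLp b ∞ (volume.restrict Ω)) (hc : MemLp c ∞ (volume.restrict Ω))
    (hδ : MemLp δ ∞ (volume.restrict Ω)) (hdiv : HasWeakDiv Ω b δ)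
    (hnonneg : ∀ᵐ x ∂volume.restrict Ω, 0 ≤ -δ x + 2 * c x)
    {v : L2Pair Ω} (hv : v ∈ h10 Ω) :
    0 ≤ (∫ x in Ω, ⟪b x, v.snd x⟫ * v.fst x) + ∫ x in Ω, c x * v.fst x * v.fst x := by
  obtain ⟨A, hA⟩ := exists_convectionForm hb
  obtain ⟨A', hA'⟩ := exists_reactionForm hc
  obtain ⟨A'', hA''⟩ := exists_reactionForm hδ
  refine h10_induction (Pr := fun v : L2Pair Ω =>
    0 ≤ (∫ x in Ω, ⟪b x, v.snd x⟫ * v.fst x) + ∫ x in Ω, c x * v.fst x * v.fst x) ?_ ?_ hv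
  · simp only [← (hA _ _).2, ← (hA' _ _).2]
    exact isClosed_le continuous_const (by fun_prop)
  · intro φ hφ w h1 h2
    -- Testing the weak divergence with φ² and using ∇(φ²) = 2φ∇φ shows that twice the quantity in
    -- question is ∫ (-δ + 2c) φ².
    have h3 := hdiv _ hφ.mul_self
    have h4 : ∫ x in Ω, ⟪b x, gradient (φ * φ) x⟫
        = 2 * ∫ x in Ω, ⟪b x, w.snd x⟫ * w.fst x := by
      rw [← integral_const_mul]
      refine integral_congr_ae ?_
      filter_upwards [h1, h2] with x hx hx'
      rw [gradient_mul_self_of_differentiable hφ.differentiable, hx, hx', inner_smul_right]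
      ring
    have h5 : ∫ x in Ω, δ x * (φ * φ) x = ∫ x in Ω, δ x * w.fst x * w.fst x := by
      refine integral_congr_ae ?_
      filter_upwards [h1] with x hx
      rw [hx, Pi.mul_apply]
      ring
    rw [h4, h5] at h3
    have h6 : 0 ≤ ∫ x in Ω, (-(δ x * w.fst x * w.fst x) + 2 * (c x * w.fst x * w.fst x)) := by
      refine integral_nonneg_of_ae ?_
      filter_upwards [hnonneg] with x hx
      have := mul_nonneg hx (mul_self_nonneg (w.fst x))
      simp only [Pi.zero_apply]
      linarith
    rw [integral_add (hA'' w w).1.fun_neg ((hA' w w).1.const_mul _), integral_neg,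
      integral_const_mul] at h6
    linarith

/-! ### Boundedness and coercivity of the bilinear form. -/

lemma Problem.IsAdmissible.exists_energy_ge {d : ℕ} (hd : 1 ≤ d) {D : Problem d}
    {𝒯₀ : Mesh d} (hD : D.IsAdmissible 𝒯₀) :
    ∃ κ : ℝ, 0 < κ ∧ ∀ v : H10 D.Ω, κ * ‖v‖ ^ 2 ≤ D.a v v := by
  obtain ⟨A₁, hA₁⟩ := exists_principalForm hD.memLp_K
  obtain ⟨κ, hκ, hell⟩ := hD.elliptic_K
  obtain ⟨R, hR⟩ := hD.domain.isBounded.exists_norm_le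
  have hR' : ∀ x ∈ D.Ω, ‖x‖ ≤ max R 0 := fun x hx => (hR x hx).trans (le_max_left _ _)
  -- Friedrichs' inequality bounds the squared H¹-norm by M times the squared gradient norm.
  set M : ℝ := (2 * max R 0) ^ 2 + 1 with hM
  have hMpos : 0 < M := by positivity
  refine ⟨κ / M, div_pos hκ hMpos, fun v => ?_⟩
  have h0 : ‖v‖ ^ 2 ≤ M * ‖(v : L2Pair D.Ω).snd‖ ^ 2 := by
    have h1 : ‖v‖ ^ 2 = ‖(v : L2Pair D.Ω).fst‖ ^ 2 + ‖(v : L2Pair D.Ω).snd‖ ^ 2 :=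
      WithLp.prod_norm_sq_eq_of_L2 (v : L2Pair D.Ω)
    have h2 := h10_friedrichs hd (le_max_right R 0) hR' v.2
    have h3 := pow_le_pow_left₀ (norm_nonneg _) h2 2
    rw [h1, hM]
    linarith [mul_pow (2 * max R 0) ‖(v : L2Pair D.Ω).snd‖ 2]
  have h1 : κ * ‖(v : L2Pair D.Ω).snd‖ ^ 2 ≤ D.a v v := by
    rw [norm_sq_eq_setIntegral, ← integral_const_mul]
    refine integral_mono_ae ?_ (hA₁ v v).1 ?_
    · exact ((Lp.memLp (v : L2Pair D.Ω).snd).integrable_norm_pow (by simp)).const_mul κ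
    · filter_upwards [hell] with x hx
      exact hx _
  calc κ / M * ‖v‖ ^ 2 ≤ κ / M * (M * ‖(v : L2Pair D.Ω).snd‖ ^ 2) := by gcongr
    _ = κ * ‖(v : L2Pair D.Ω).snd‖ ^ 2 := by field_simp
    _ ≤ _ := h1

lemma Problem.IsAdmissible.exists_bounded_form {d : ℕ} {D : Problem d}
    {𝒯₀ : Mesh d} (hD : D.IsAdmissible 𝒯₀) :
    ∃ B : H10 D.Ω →L[ℝ] H10 D.Ω →L[ℝ] ℝ, ∀ v w, B v w = D.form v w := by
  obtain ⟨A₁, hA₁⟩ := exists_principalForm hD.memLp_K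
  obtain ⟨A₂, hA₂⟩ := exists_convectionForm hD.memLp_b
  obtain ⟨A₃, hA₃⟩ := exists_reactionForm hD.memLp_c
  refine ⟨(A₁ + A₂ + A₃).bilinearComp (h10 D.Ω).subtypeL (h10 D.Ω).subtypeL, fun v w => ?_⟩
  simp only [ContinuousLinearMap.bilinearComp_apply, _root_.add_apply, Submodule.subtypeL_apply]
  rw [(hA₁ v w).2, (hA₂ v w).2, (hA₃ v w).2]
  rfl

lemma Problem.IsAdmissible.exists_energy_le {d : ℕ} {D : Problem d}
    {𝒯₀ : Mesh d} (hD : D.IsAdmissible 𝒯₀) :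
    ∃ C : ℝ, 0 < C ∧ ∀ v : H10 D.Ω, D.a v v ≤ C * ‖v‖ ^ 2 := by
  obtain ⟨A₁, hA₁⟩ := exists_principalForm hD.memLp_K
  refine ⟨‖A₁‖ + 1, by positivity, fun v => ?_⟩
  have h1 : A₁ v v ≤ ‖A₁‖ * ‖v‖ * ‖v‖ :=
    (le_abs_self _).trans (A₁.le_opNorm₂ (v : L2Pair D.Ω) v)
  have h2 : D.a v v = A₁ v v := ((hA₁ v v).2).symm
  rw [h2]
  linarith [sq_nonneg ‖v‖]

lemma Problem.IsAdmissible.energy_le_form {d : ℕ} {D : Problem d}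
    {𝒯₀ : Mesh d} (hD : D.IsAdmissible 𝒯₀) (v : H10 D.Ω) : D.a v v ≤ D.form v v := by
  obtain ⟨δ, hδ, hdiv, hnonneg⟩ := hD.div_b
  have h1 : 0 ≤ (∫ x in D.Ω, ⟪D.b x, v.grad x⟫ * v.val x) +
      ∫ x in D.Ω, D.c x * v.val x * v.val x :=
    h10_lowerOrder_nonneg hD.memLp_b hD.memLp_c hδ hdiv hnonneg v.2
  rw [Problem.form]
  linarith

/-- The bilinear form of the problem is a bounded and coercive form on `H¹₀(Ω)`, and the energy
norm is equivalent to the norm of `H¹₀(Ω)`. -/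
theorem Problem.IsAdmissible.exists_coercive_form {d : ℕ} (hd : 1 ≤ d) {D : Problem d}
    {𝒯₀ : Mesh d} (hD : D.IsAdmissible 𝒯₀) :
    ∃ (A : H10 D.Ω →L[ℝ] H10 D.Ω →L[ℝ] ℝ) (α β : ℝ), 0 < α ∧ 0 < β ∧
      (∀ v w, A v w = D.form v w) ∧ (∀ v, α * ‖v‖ ^ 2 ≤ A v v) ∧
      ∀ v, α * ‖v‖ ≤ D.enorm v ∧ D.enorm v ≤ β * ‖v‖ := by
  obtain ⟨B, hB⟩ := hD.exists_bounded_form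
  obtain ⟨κ, hκ, hcoer⟩ := hD.exists_energy_ge hd
  obtain ⟨C, hC, hup⟩ := hD.exists_energy_le
  -- One constant α serves two bounds: coercivity needs α ≤ κ, and the lower bound of the energy
  -- norm needs α ≤ √κ.
  refine ⟨B, min κ √κ, √C, lt_min hκ (Real.sqrt_pos.2 hκ), Real.sqrt_pos.2 hC, hB, ?_,
    fun v => ⟨?_, ?_⟩⟩
  · intro v
    have h3 : min κ √κ * ‖v‖ ^ 2 ≤ κ * ‖v‖ ^ 2 :=
      mul_le_mul_of_nonneg_right (min_le_left _ _) (sq_nonneg _)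
    rw [hB]
    exact h3.trans ((hcoer v).trans (hD.energy_le_form v))
  · have h1 : √κ * ‖v‖ = √(κ * ‖v‖ ^ 2) := by
      rw [Real.sqrt_mul hκ.le, Real.sqrt_sq (norm_nonneg v)]
    refine (mul_le_mul_of_nonneg_right (min_le_right _ _) (norm_nonneg _)).trans ?_
    rw [h1]
    exact Real.sqrt_le_sqrt (hcoer v)
  · refine (Real.sqrt_le_sqrt (hup v)).trans ?_
    rw [Real.sqrt_mul hC.le, Real.sqrt_sq (norm_nonneg v)]

/-! ### Preconditioned GMRES with restart -/

section GMRES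

variable {N : ℕ} {B P : Matrix (Fin N) (Fin N) ℝ}

/-- The inner product `(P⁻¹ a, b)₂`. -/
noncomputable def precInner (P : Matrix (Fin N) (Fin N) ℝ) (a b : Fin N → ℝ) : ℝ := (P⁻¹ *ᵥ a) ⬝ᵥ b

lemma precNorm_eq (a : Fin N → ℝ) : precNorm P a = √(precInner P a a) := rfl

lemma precInner_smul_left (t : ℝ) (a b : Fin N → ℝ) :
    precInner P (t • a) b = t * precInner P a b := by
  simp [precInner, mulVec_smul]

lemma precInner_smul_right (t : ℝ) (a b : Fin N → ℝ) :
    precInner P a (t • b) = t * precInner P a b := by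
  simp [precInner]

lemma precInner_sub_left (a b c : Fin N → ℝ) :
    precInner P (a - b) c = precInner P a c - precInner P b c := by
  simp [precInner, mulVec_sub, sub_dotProduct]

lemma precInner_sub_right (a b c : Fin N → ℝ) :
    precInner P a (b - c) = precInner P a b - precInner P a c := by
  simp [precInner, dotProduct_sub]

lemma precInner_zero_right (a : Fin N → ℝ) : precInner P a 0 = 0 := by simp [precInner]

lemma precInner_sum_left {ι : Type*} (s : Finset ι) (f : ι → Fin N → ℝ) (a : Fin N → ℝ) :
    precInner P (∑ i ∈ s, f i) a = ∑ i ∈ s, precInner P (f i) a := by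
  simp [precInner, mulVec_sum, sum_dotProduct]

lemma precInner_sum_right {ι : Type*} (s : Finset ι) (f : ι → Fin N → ℝ) (a : Fin N → ℝ) :
    precInner P a (∑ i ∈ s, f i) = ∑ i ∈ s, precInner P a (f i) := by
  simp [precInner, dotProduct_sum]

/-- This is why the Arnoldi process carries both w̃ and w = P w̃: Euclidean products with w̃ are
`P⁻¹`-products with w, and `P⁻¹` is never applied. -/
lemma precInner_mulVec_left (hP : P.PosDef) (a b : Fin N → ℝ) :
    precInner P (P *ᵥ a) b = a ⬝ᵥ b := by
  have : P⁻¹ * P = 1 := nonsing_inv_mul _ ((isUnit_iff_isUnit_det _).1 hP.isUnit)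
  rw [precInner, mulVec_mulVec, this, one_mulVec]

lemma precInner_comm (hP : P.PosDef) (a b : Fin N → ℝ) : precInner P a b = precInner P b a := by
  have h : (P⁻¹)ᵀ = P⁻¹ := by simpa using hP.inv.isHermitian.eq
  rw [precInner, precInner, dotProduct_comm, dotProduct_mulVec, ← mulVec_transpose, h]

lemma precInner_self_nonneg (hP : P.PosDef) (a : Fin N → ℝ) : 0 ≤ precInner P a a := by
  have := hP.inv.posSemidef.dotProduct_mulVec_nonneg a
  rw [precInner, dotProduct_comm]
  simpa using this

lemma precNorm_sq (hP : P.PosDef) (a : Fin N → ℝ) : precNorm P a ^ 2 = precInner P a a :=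
  Real.sq_sqrt (precInner_self_nonneg hP a)

lemma precNorm_zero : precNorm P 0 = 0 := by simp [precNorm]

lemma eq_zero_of_precNorm_eq_zero (hP : P.PosDef) {a : Fin N → ℝ} (h : precNorm P a = 0) :
    a = 0 := by
  by_contra ha
  have h1 := hP.inv.dotProduct_mulVec_pos ha
  have h2 := precNorm_sq hP a
  rw [h, precInner, dotProduct_comm] at h2
  simp only [star_trivial] at h1
  linarith

/-- Valid also at breakdown: if the norm vanishes then so does w, and the convention 0⁻¹ = 0 turns
the normalized vector into zero. Hence Arnoldi vectors are normalized or zero below, and no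
breakdown case has to be excluded. -/
lemma smul_inv_smul_precNorm (hP : P.PosDef) (w : Fin N → ℝ) :
    precNorm P w • (precNorm P w)⁻¹ • w = w := by
  by_cases h : precNorm P w = 0
  · rw [eq_zero_of_precNorm_eq_zero hP h]; simp
  · exact smul_inv_smul₀ h w

lemma precNorm_eq_zero_of_inv_smul (hP : P.PosDef) {w : Fin N → ℝ}
    (h : (precNorm P w)⁻¹ • w = 0) : precNorm P w = 0 := by
  have := smul_inv_smul_precNorm hP w
  rw [h, smul_zero] at this
  rw [← this, precNorm_zero]

lemma inv_precNorm_smul (hP : P.PosDef) (w : Fin N → ℝ) :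
    (precNorm P w)⁻¹ • w = 0 ∨
      precInner P ((precNorm P w)⁻¹ • w) ((precNorm P w)⁻¹ • w) = 1 := by
  by_cases h : precNorm P w = 0
  · left; rw [h]; simp
  · right
    rw [precInner_smul_left, precInner_smul_right, ← precNorm_sq hP]
    field_simp

/-- The vectors `v (s + 1), …, v (s + L)` are pairwise orthogonal and either normalized or zero,
and `vt` contains their images under `P⁻¹`. -/
structure IsArnoldiBasis (P : Matrix (Fin N) (Fin N) ℝ) (v vt : ℕ → Fin N → ℝ) (s L : ℕ) :
    Prop where
  prec : ∀ i, 1 ≤ i → i ≤ L → v (s + i) = P *ᵥ vt (s + i)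
  unit : ∀ i, 1 ≤ i → i ≤ L → v (s + i) = 0 ∨ precInner P (v (s + i)) (v (s + i)) = 1
  orth : ∀ i j, 1 ≤ i → i < j → j ≤ L → precInner P (v (s + i)) (v (s + j)) = 0

lemma IsArnoldiBasis.mono {v vt : ℕ → Fin N → ℝ} {s L L' : ℕ} (h : IsArnoldiBasis P v vt s L)
    (hL : L' ≤ L) : IsArnoldiBasis P v vt s L' :=
  ⟨fun i h1 h2 => h.prec i h1 (h2.trans hL), fun i h1 h2 => h.unit i h1 (h2.trans hL),
    fun i j h1 h2 h3 => h.orth i j h1 h2 (h3.trans hL)⟩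

lemma IsArnoldiBasis.orth_of_ne (hP : P.PosDef) {v vt : ℕ → Fin N → ℝ} {s L : ℕ}
    (h : IsArnoldiBasis P v vt s L) {i j : ℕ} (hi : 1 ≤ i) (hj : 1 ≤ j) (hiL : i ≤ L)
    (hjL : j ≤ L) (hij : i ≠ j) : precInner P (v (s + i)) (v (s + j)) = 0 := by
  rcases lt_or_gt_of_ne hij with h1 | h1
  · exact h.orth i j hi h1 hjL
  · rw [precInner_comm hP]; exact h.orth j i hj h1 hiL

section Cycle

variable {v vt : ℕ → Fin N → ℝ} {kmax k s K : ℕ}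

lemma arnoldiW_snd (hs : gmresStart kmax k = s) (h : IsArnoldiBasis P v vt s K) {m : ℕ}
    (hm : m ≤ K) :
    (arnoldiW B P kmax v vt k m).2 = P *ᵥ (arnoldiW B P kmax v vt k m).1 := by
  induction m with
  | zero => rfl
  | succ m ih =>
    simp only [arnoldiW, hs, ih (by omega), mulVec_sub, mulVec_smul,
      h.prec (m + 1) (by omega) hm]

lemma arnoldiW_inner (hP : P.PosDef) (hs : gmresStart kmax k = s)
    (h : IsArnoldiBasis P v vt s K) {m : ℕ} (hm : m ≤ K) (y : Fin N → ℝ) :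
    (arnoldiW B P kmax v vt k m).1 ⬝ᵥ y = precInner P (arnoldiW B P kmax v vt k m).2 y := by
  rw [arnoldiW_snd hs h hm, precInner_mulVec_left hP]

/-- Each modified Gram–Schmidt step removes the component along the current vector and, by mutual
orthogonality of the Arnoldi vectors, does not disturb the earlier ones. Orthogonality to a zero
vector is trivial. -/
lemma arnoldiW_orth (hP : P.PosDef) (hs : gmresStart kmax k = s)
    (h : IsArnoldiBasis P v vt s K) {m : ℕ} (hm : m ≤ K) {i : ℕ} (hi : 1 ≤ i) (him : i ≤ m) :
    precInner P (arnoldiW B P kmax v vt k m).2 (v (s + i)) = 0 := by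
  induction m with
  | zero => omega
  | succ m ih =>
    simp only [arnoldiW, hs]
    rw [arnoldiW_inner hP hs h (by omega), precInner_sub_left, precInner_smul_left]
    rcases Nat.lt_or_ge m i with h1 | h1
    · have : i = m + 1 := by omega
      subst this
      rcases h.unit (m + 1) hi hm with h2 | h2
      · simp [h2, precInner_zero_right]
      · rw [h2]; ring
    · rw [ih (by omega) h1, h.orth_of_ne hP (by omega) hi hm (by omega) (by omega)]
      ring

/-- The Gram–Schmidt subtractions telescope; no orthogonality is involved. With m = K this is one
column of the Arnoldi relation. -/
lemma mulVec_mulVec_eq_arnoldi (hs : gmresStart kmax k = s) (m : ℕ) :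
    P *ᵥ (B *ᵥ v k) = ∑ i ∈ Finset.range m,
      ((arnoldiW B P kmax v vt k i).1 ⬝ᵥ v (s + (i + 1))) • v (s + (i + 1)) +
        (arnoldiW B P kmax v vt k m).2 := by
  induction m with
  | zero => simp [arnoldiW]
  | succ m ih =>
    rw [ih, Finset.sum_range_succ]
    simp only [arnoldiW, hs]
    abel

lemma arnoldiSub_eq (hP : P.PosDef) (hs : gmresStart kmax k = s)
    (h : IsArnoldiBasis P v vt s (gmresK kmax k)) :
    arnoldiSub B P kmax v vt k =
      precNorm P (arnoldiW B P kmax v vt k (gmresK kmax k)).2 := by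
  rw [precNorm_eq, ← arnoldiW_inner hP hs h le_rfl]
  rfl

/-- In the last step of a cycle the sequence v continues with the restart vector instead of the next
Arnoldi vector. The latter is still needed to read the projected residual as a residual, so it is
inserted by `Function.update`. -/
lemma IsArnoldiBasis.update (hP : P.PosDef) (hs : gmresStart kmax k = s)
    (hK : gmresK kmax k = K) (h : IsArnoldiBasis P v vt s K) :
    IsArnoldiBasis P
      (Function.update v (s + (K + 1))
        ((arnoldiSub B P kmax v vt k)⁻¹ • (arnoldiW B P kmax v vt k K).2))
      (Function.update vt (s + (K + 1))
        ((arnoldiSub B P kmax v vt k)⁻¹ • (arnoldiW B P kmax v vt k K).1)) s (K + 1) := by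
  have hsub : arnoldiSub B P kmax v vt k = precNorm P (arnoldiW B P kmax v vt k K).2 := by
    subst hK; exact arnoldiSub_eq hP hs h
  have hne : ∀ i, i ≤ K → s + i ≠ s + (K + 1) := fun i hi => by omega
  refine ⟨fun i h1 h2 => ?_, fun i h1 h2 => ?_, fun i j h1 h2 h3 => ?_⟩
  · rcases Nat.lt_or_ge K i with h4 | h4
    · have : i = K + 1 := by omega
      subst this
      simp only [Function.update_self, mulVec_smul, arnoldiW_snd hs h le_rfl]
    · simp only [Function.update_of_ne (hne i h4), h.prec i h1 h4]
  · rcases Nat.lt_or_ge K i with h4 | h4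
    · have : i = K + 1 := by omega
      subst this
      simp only [Function.update_self, hsub]
      exact inv_precNorm_smul hP _
    · simp only [Function.update_of_ne (hne i h4)]
      exact h.unit i h1 h4
  · rw [Function.update_of_ne (hne i (by omega))]
    rcases Nat.lt_or_ge K j with h4 | h4
    · have : j = K + 1 := by omega
      subst this
      rw [Function.update_self, precInner_smul_right, precInner_comm hP,
        arnoldiW_orth hP hs h le_rfl h1 (by omega), mul_zero]
    · rw [Function.update_of_ne (hne j h4)]
      exact h.orth i j h1 h2 h4

end Cycle

/-! ### Restart cycles and residual minimization. -/

lemma gmresStart_add {kmax m j : ℕ} (hj : 1 ≤ j) (hjk : j ≤ kmax) :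
    gmresStart kmax (m * kmax + j) = m * kmax := by
  have h1 : m * kmax + j - 1 = (j - 1) + m * kmax := by omega
  rw [gmresStart, h1, Nat.add_mul_div_right _ _ (by omega), Nat.div_eq_of_lt (by omega), zero_add]

lemma gmresK_add {kmax m j : ℕ} (hj : 1 ≤ j) (hjk : j ≤ kmax) :
    gmresK kmax (m * kmax + j) = j := by
  have h1 : m * kmax + j - 1 = (j - 1) + m * kmax := by omega
  rw [gmresK, h1, Nat.add_mul_mod_self_right, Nat.mod_eq_of_lt (by omega)]
  omega

lemma gmresStart_add_gmresK {kmax k : ℕ} (hk : 1 ≤ k) :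
    gmresStart kmax k + gmresK kmax k = k := by
  have := Nat.div_add_mod' (k - 1) kmax
  simp only [gmresStart, gmresK]
  omega

lemma gmresK_le {kmax k : ℕ} (hkmax : 1 ≤ kmax) : gmresK kmax k ≤ kmax := by
  have := Nat.mod_lt (k - 1) hkmax
  simp only [gmresK]
  omega

/-- A linear combination of pairwise orthogonal vectors, each of which is normalized or comes
with a zero coefficient. -/
lemma precNorm_sum_smul {n : ℕ} (V : Fin n → Fin N → ℝ) (z : Fin n → ℝ)
    (horth : ∀ i j, i ≠ j → precInner P (V i) (V j) = 0)
    (hunit : ∀ i, V i = 0 ∨ precInner P (V i) (V i) = 1) (hz : ∀ i, V i = 0 → z i = 0) :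
    precNorm P (∑ i, z i • V i) = ‖WithLp.toLp 2 z‖ := by
  rw [EuclideanSpace.norm_eq, precNorm_eq]
  congr 1
  rw [precInner_sum_left]
  refine Finset.sum_congr rfl fun i _ => ?_
  rw [precInner_sum_right, Finset.sum_eq_single i]
  · rw [precInner_smul_left, precInner_smul_right]
    rcases hunit i with h | h
    · simp [hz i h]
    · rw [h]; simp [pow_two]
  · intro j _ hj
    rw [precInner_smul_left, precInner_smul_right, horth i j hj.symm]
    ring
  · simp

variable {r : Fin N → ℝ} {kmax : ℕ} {x v vt : ℕ → Fin N → ℝ}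

/-- The vectors computed after the restart at `m * kmax`. -/
lemma isArnoldiBasis_of_steps (hP : P.PosDef) {m : ℕ}
    (hinit : IsGMRESInit B P r x v vt) {L : ℕ} (hL : L < kmax)
    (hstep : ∀ j, 1 ≤ j → j ≤ m * kmax + L → IsGMRESStep B P r kmax x v vt j) :
    v (m * kmax + 1) = (precNorm P (P *ᵥ (r - B *ᵥ x (m * kmax))))⁻¹ •
        (P *ᵥ (r - B *ᵥ x (m * kmax))) ∧
      IsArnoldiBasis P v vt (m * kmax) (L + 1) := by
  have hv : v (m * kmax + 1) = (precNorm P (P *ᵥ (r - B *ᵥ x (m * kmax))))⁻¹ •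
        (P *ᵥ (r - B *ᵥ x (m * kmax))) ∧ v (m * kmax + 1) = P *ᵥ vt (m * kmax + 1) := by
    -- The first vector of a cycle comes from the initialization or from the restart branch of the
    -- preceding step.
    rcases Nat.eq_zero_or_pos (m * kmax) with h | h
    · rw [h, zero_add, hinit.v_one, hinit.vt_one, mulVec_smul]
      simp
    · have h1 := hstep (m * kmax) h (by omega)
      rw [h1.v_succ, h1.vt_succ]
      simp [mulVec_smul]
  refine ⟨hv.1, ?_⟩
  induction L with
  | zero =>
    have h1 : ∀ i, 1 ≤ i → i ≤ 0 + 1 → i = 1 := fun i h1 h2 => by omega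
    refine ⟨fun i h2 h3 => ?_, fun i h2 h3 => ?_, fun i j h2 h3 h4 => by omega⟩
    · rw [h1 i h2 h3]; exact hv.2
    · rw [h1 i h2 h3, hv.1]
      exact inv_precNorm_smul hP _
  | succ L ih =>
    have ih' := ih (by omega) fun j h1 h2 => hstep j h1 (by omega)
    have hs := gmresStart_add (m := m) (j := L + 1) (kmax := kmax) (by omega) (by omega)
    have hK := gmresK_add (m := m) (j := L + 1) (kmax := kmax) (by omega) (by omega)
    have h1 := hstep (m * kmax + (L + 1)) (by omega) le_rfl
    have h2 : (m * kmax + (L + 1)) % kmax ≠ 0 := by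
      rw [add_comm, Nat.add_mul_mod_self_right, Nat.mod_eq_of_lt hL]
      omega
    have h3 := h1.v_succ
    have h4 := h1.vt_succ
    rw [if_neg h2, hK] at h3 h4
    -- Inside a cycle the stored vectors are exactly the inserted ones, so the update is trivial.
    have h5 := ih'.update (B := B) hP hs hK
    rw [← h3, ← h4] at h5
    simpa only [add_assoc, Function.update_eq_self] using h5

/-- Each GMRES iterate minimizes the preconditioned residual over a space that contains the
direction of the preconditioned residual at the last restart. -/
theorem gmres_residual_le (hP : P.PosDef) (hkmax : 1 ≤ kmax)
    (hinit : IsGMRESInit B P r x v vt) {k : ℕ} (hk : 1 ≤ k)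
    (hstep : ∀ j, 1 ≤ j → j ≤ k → IsGMRESStep B P r kmax x v vt j) (t : ℝ) :
    precNorm P (P *ᵥ (r - B *ᵥ x k)) ≤
      precNorm P (P *ᵥ (r - B *ᵥ x (gmresStart kmax k)) -
        t • (P *ᵥ (B *ᵥ (P *ᵥ (r - B *ᵥ x (gmresStart kmax k)))))) := by
  obtain ⟨y, hmin, hx⟩ := (hstep k hk le_rfl).iterate
  have hsK := gmresStart_add_gmresK (kmax := kmax) hk
  have hKle := gmresK_le (k := k) hkmax
  have hK1 : 1 ≤ gmresK kmax k := by simp [gmresK]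
  obtain ⟨m, hm⟩ : ∃ m, gmresStart kmax k = m * kmax := ⟨_, rfl⟩
  set s := gmresStart kmax k with hs
  have hH : ∀ (i : Fin (gmresK kmax k + 1)) (j : Fin (gmresK kmax k)),
      hessenberg B P kmax v vt k i j = arnoldiEntry B P kmax v vt (s + (j + 1)) (i + 1) :=
    fun i j => rfl
  generalize hessenberg B P kmax v vt k = H at *
  generalize hKdef : gmresK kmax k = K at *
  have hstart : ∀ j, 1 ≤ j → j ≤ K → gmresStart kmax (s + j) = s := fun j h1 h2 => by
    rw [hm]; exact gmresStart_add h1 (h2.trans hKle)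
  have hgK : ∀ j, 1 ≤ j → j ≤ K → gmresK kmax (s + j) = j := fun j h1 h2 => by
    rw [hm]; exact gmresK_add h1 (h2.trans hKle)
  -- Steps up to s + K - 1 produce K basis vectors; the vector from step k = s + K is treated
  -- separately, as it may be replaced by a restart.
  obtain ⟨hv1, hbasis⟩ := isArnoldiBasis_of_steps (m := m) (L := K - 1) hP hinit
    (by omega) fun j h1 h2 => hstep j h1 (by omega)
  rw [← hm] at hv1 hbasis
  rw [show K - 1 + 1 = K by omega] at hbasis
  set res := P *ᵥ (r - B *ᵥ x s) with hres
  set β := precNorm P res with hβ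
  have hβv : β • v (s + 1) = res := by
    rw [hv1]; exact smul_inv_smul_precNorm hP res
  -- the basis extended by the vector computed in step `k`
  set V : ℕ → Fin N → ℝ := Function.update v (s + (K + 1))
    ((arnoldiSub B P kmax v vt k)⁻¹ • (arnoldiW B P kmax v vt k K).2) with hV
  have hVbasis := hbasis.update (B := B) hP hs.symm hKdef
  rw [← hV] at hVbasis
  have hVv : ∀ i, i ≤ K → V (s + i) = v (s + i) := fun i hi =>
    Function.update_of_ne (by omega) _ _
  have hsub : ∀ j, 1 ≤ j → j ≤ K → arnoldiSub B P kmax v vt (s + j) =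
      precNorm P (arnoldiW B P kmax v vt (s + j) j).2 := fun j h1 h2 => by
    have h3 := arnoldiSub_eq (B := B) (k := s + j) hP (hstart j h1 h2)
      (by rw [hgK j h1 h2]; exact hbasis.mono h2)
    rw [h3, hgK j h1 h2]
  have hVsucc : ∀ j, 1 ≤ j → j ≤ K → V (s + (j + 1)) =
      (arnoldiSub B P kmax v vt (s + j))⁻¹ • (arnoldiW B P kmax v vt (s + j) j).2 := by
    intro j h1 h2
    rcases Nat.lt_or_ge j K with h3 | h3
    · have h4 := (hstep (s + j) (by omega) (by omega)).v_succ
      have h5 : (s + j) % kmax ≠ 0 := by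
        rw [hm, add_comm, Nat.add_mul_mod_self_right, Nat.mod_eq_of_lt (by omega)]
        omega
      rw [if_neg h5, hgK j h1 h2] at h4
      rw [hVv _ h3]
      exact h4
    · have h4 : j = K := by omega
      subst h4
      rw [hV, Function.update_self, hsK]
  -- the Arnoldi relation
  have hrel : ∀ j : Fin K, P *ᵥ (B *ᵥ v (s + (j + 1))) =
      ∑ i : Fin (K + 1), H i j • V (s + (i + 1)) := by
    intro j
    have hj1 : 1 ≤ (j : ℕ) + 1 := by omega
    have hj2 : (j : ℕ) + 1 ≤ K := j.2
    have h1 : ∑ i : Fin (K + 1), H i j • V (s + (i + 1)) = ∑ i ∈ Finset.range (j + 1 + 1),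
        arnoldiEntry B P kmax v vt (s + (j + 1)) (i + 1) • V (s + (i + 1)) := by
      simp only [hH]
      rw [Fin.sum_univ_eq_sum_range (fun i => arnoldiEntry B P kmax v vt (s + (j + 1)) (i + 1) •
        V (s + (i + 1))) (K + 1)]
      -- Hessenberg structure: entries below the subdiagonal vanish.
      refine (Finset.sum_subset (Finset.range_mono (by omega)) fun i _ hi => ?_).symm
      rw [Finset.mem_range] at hi
      rw [arnoldiEntry, hgK _ hj1 hj2, if_neg (by omega), if_neg (by omega), zero_smul]
    rw [h1, Finset.sum_range_succ,
      mulVec_mulVec_eq_arnoldi (vt := vt) (kmax := kmax) (hstart _ hj1 hj2) ((j : ℕ) + 1)]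
    congr 1
    · refine Finset.sum_congr rfl fun i hi => ?_
      rw [Finset.mem_range] at hi
      rw [hVv _ (by omega), arnoldiEntry, hgK _ hj1 hj2, if_pos (by omega), hstart _ hj1 hj2]
      rfl
    · rw [arnoldiEntry, hgK _ hj1 hj2, if_neg (by omega), if_pos rfl, hVsucc _ hj1 hj2,
        hsub _ hj1 hj2, smul_inv_smul_precNorm hP]
  -- the norm of the residual is the norm of the projected residual
  have hnorm : ∀ z : Fin K → ℝ,
      precNorm P (P *ᵥ (r - B *ᵥ (x s + ∑ j, z j • v (s + (j + 1))))) =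
        ‖WithLp.toLp 2 (Pi.single 0 β - H *ᵥ z)‖ := by
    intro z
    have h1 : P *ᵥ (r - B *ᵥ (x s + ∑ j, z j • v (s + (j + 1)))) =
        ∑ i : Fin (K + 1), (Pi.single 0 β - H *ᵥ z : Fin (K + 1) → ℝ) i • V (s + (i + 1)) := by
      have h2 : P *ᵥ (r - B *ᵥ (x s + ∑ j, z j • v (s + (j + 1)))) =
          res - ∑ j, z j • (P *ᵥ (B *ᵥ v (s + (j + 1)))) := by
        simp only [hres, mulVec_add, mulVec_sub, mulVec_sum, mulVec_smul]
        abel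
      have h3 : ∑ i : Fin (K + 1), (Pi.single 0 β : Fin (K + 1) → ℝ) i • V (s + (i + 1)) = res := by
        rw [Finset.sum_eq_single 0 (fun i _ hi => by rw [Pi.single_eq_of_ne hi, zero_smul])
          (by simp), Pi.single_eq_same, Fin.val_zero, zero_add, hVv 1 hK1, hβv]
      have h4 : ∑ i : Fin (K + 1), (H *ᵥ z) i • V (s + (i + 1)) =
          ∑ j, z j • (P *ᵥ (B *ᵥ v (s + (j + 1)))) := by
        simp only [hrel, mulVec, dotProduct, Finset.sum_smul, Finset.smul_sum, smul_smul]
        rw [Finset.sum_comm]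
        simp only [mul_comm]
      rw [h2, ← h3, ← h4, ← Finset.sum_sub_distrib]
      simp only [Pi.sub_apply, sub_smul]
    rw [h1]
    refine precNorm_sum_smul (fun i : Fin (K + 1) => V (s + (i + 1))) _ (fun i j hij => ?_)
      (fun i => hVbasis.unit _ (by omega) (by omega)) (fun i hi => ?_)
    · exact hVbasis.orth_of_ne hP (by omega) (by omega) (by omega) (by omega)
        (fun h => hij (Fin.ext (by omega)))
    -- A vanishing basis vector must have coefficient zero. If the first one vanishes then β = 0; a
    -- row of H belonging to a zero vector consists of products with that vector, of the norm it
    -- failed to be normalized by, and of structural zeros.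
    · have h5 : (Pi.single 0 β : Fin (K + 1) → ℝ) i = 0 := by
        by_cases h : i = 0
        · subst h
          rw [Fin.val_zero, zero_add, hVv 1 hK1, hv1] at hi
          rw [Pi.single_eq_same]
          exact precNorm_eq_zero_of_inv_smul hP hi
        · exact Pi.single_eq_of_ne h _
      have h6 : (H *ᵥ z) i = 0 := by
        rw [mulVec, dotProduct]
        refine Finset.sum_eq_zero fun j _ => ?_
        have hj1 : 1 ≤ (j : ℕ) + 1 := by omega
        have hj2 : (j : ℕ) + 1 ≤ K := j.2
        have : H i j = 0 := by
          rw [hH, arnoldiEntry, hgK _ hj1 hj2, hstart _ hj1 hj2]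
          split_ifs with h7 h8
          · rw [← hVv _ (by omega), hi, dotProduct_zero]
          · rw [hsub _ hj1 hj2]
            have h9 : (i : ℕ) = j + 1 := by omega
            rw [h9, hVsucc _ hj1 hj2, hsub _ hj1 hj2] at hi
            exact precNorm_eq_zero_of_inv_smul hP hi
          · rfl
        rw [this, zero_mul]
      rw [Pi.sub_apply, h5, h6, sub_zero]
  -- The competitor tβ e₁ corresponds to the correction t times the restart residual, because β
  -- times the first Arnoldi vector is that residual.
  have hfin := hmin (Pi.single ⟨0, hK1⟩ (t * β))
  rw [← hnorm, ← hnorm, ← hx] at hfin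
  refine hfin.trans_eq (congrArg _ ?_)
  rw [Finset.sum_eq_single ⟨0, hK1⟩ (fun i _ hi => by rw [Pi.single_eq_of_ne hi, zero_smul])
    (by simp), Pi.single_eq_same, zero_add, mul_smul, hβv]
  simp only [hres, mulVec_add, mulVec_sub, mulVec_smul]
  abel

end GMRES

/-! ### Meshes and finite element spaces -/

section Mesh

variable {d : ℕ}

lemma Simplex.vert_mem_carrier (T : Simplex d) (i : Fin (d + 1)) : T.vert i ∈ T.carrier :=
  subset_convexHull ℝ _ ⟨i, rfl⟩

lemma Simplex.newVertex_mem_carrier (T : Simplex d) : T.newVertex ∈ T.carrier :=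
  (convex_convexHull ℝ _).midpoint_mem (T.vert_mem_carrier 0) (T.vert_mem_carrier _)

lemma Simplex.carrier_child₁_subset (T : Simplex d) : T.child₁.carrier ⊆ T.carrier := by
  refine convexHull_min ?_ (convex_convexHull ℝ _)
  rintro _ ⟨i, rfl⟩
  simp only [Simplex.child₁]
  split_ifs
  · exact T.vert_mem_carrier _
  · exact T.newVertex_mem_carrier
  · exact T.vert_mem_carrier _

lemma Simplex.carrier_child₂_subset (T : Simplex d) : T.child₂.carrier ⊆ T.carrier := by
  refine convexHull_min ?_ (convex_convexHull ℝ _)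
  rintro _ ⟨i, rfl⟩
  simp only [Simplex.child₂]
  split_ifs
  · exact T.vert_mem_carrier _
  · exact T.newVertex_mem_carrier
  · exact T.vert_mem_carrier _
  · exact T.vert_mem_carrier _

lemma BisectsOne.exists_ancestor {𝒯 𝒯' : Mesh d} (h : BisectsOne 𝒯 𝒯') :
    ∀ T' ∈ 𝒯', ∃ T ∈ 𝒯, T'.carrier ⊆ T.carrier := by
  classical
  obtain ⟨T, hT, rfl⟩ := h
  intro T' hT'
  rcases Finset.mem_union.1 hT' with h1 | h1
  · exact ⟨T', Finset.mem_of_mem_erase h1, subset_rfl⟩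
  · rcases Finset.mem_insert.1 h1 with rfl | h2
    · exact ⟨T, hT, T.carrier_child₁_subset⟩
    · rw [Finset.mem_singleton.1 h2]
      exact ⟨T, hT, T.carrier_child₂_subset⟩

lemma Bisects.exists_ancestor {𝒯 𝒯' : Mesh d} (h : Bisects 𝒯 𝒯') :
    ∀ T' ∈ 𝒯', ∃ T ∈ 𝒯, T'.carrier ⊆ T.carrier := by
  induction h with
  | refl => exact fun T' hT' => ⟨T', hT', subset_rfl⟩
  | tail _ hbc ih =>
    intro T' hT'
    obtain ⟨T, hT, h1⟩ := hbc.exists_ancestor T' hT'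
    obtain ⟨T'', hT'', h2⟩ := ih T hT
    exact ⟨T'', hT'', h1.trans h2⟩

/-- Each new element lies inside an old one, so the polynomial of the ancestor can be reused. -/
lemma feSpace_mono {Ω : Set (E d)} {p : ℕ} {𝒯 𝒯' : Mesh d} (h : Bisects 𝒯 𝒯') :
    feSpace Ω p 𝒯 ≤ feSpace Ω p 𝒯' := by
  rintro v ⟨w, hw, hc, hq⟩
  refine ⟨w, hw, hc, fun T' hT' => ?_⟩
  obtain ⟨T, hT, hsub⟩ := h.exists_ancestor T' hT'
  obtain ⟨q, hdeg, he⟩ := hq T hT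
  exact ⟨q, hdeg, fun x hx => he x (hsub hx)⟩

lemma IsTriangulation.nvbMesh_self {Ω : Set (E d)} {𝒯₀ : Mesh d} (h : IsTriangulation Ω 𝒯₀) :
    NVBMesh 𝒯₀ 𝒯₀ := by
  refine ⟨Relation.ReflTransGen.refl, h.conforming, fun _ κ hκ T hT T' hT' hne => ?_⟩
  have h1 := hκ T hT T' hT' hne
  have h2 : 0 ≤ volume.real T'.carrier := measureReal_nonneg
  linarith

end Mesh

/-! ### Estimator reduction -/

section Estimator

variable {d : ℕ} {D : Problem d}

lemma Problem.etaSq_nonneg (𝒯 : Mesh d) (T : Simplex d) (v : H10 D.Ω) : 0 ≤ D.etaSq 𝒯 T v := by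
  have h0 : 0 ≤ volume.real T.carrier := measureReal_nonneg
  refine add_nonneg (mul_nonneg (Real.rpow_nonneg h0 _) ?_) (mul_nonneg (Real.rpow_nonneg h0 _) ?_)
  · exact integral_nonneg fun x => sq_nonneg _
  · exact integral_nonneg fun x => sq_nonneg _

lemma Problem.eta_sq (𝒯 𝒰 : Mesh d) (v : H10 D.Ω) :
    D.eta 𝒯 𝒰 v ^ 2 = ∑ T ∈ 𝒰, D.etaSq 𝒯 T v :=
  Real.sq_sqrt (Finset.sum_nonneg fun T _ => D.etaSq_nonneg 𝒯 T v)

lemma Problem.eta_nonneg (𝒯 𝒰 : Mesh d) (v : H10 D.Ω) : 0 ≤ D.eta 𝒯 𝒰 v := Real.sqrt_nonneg _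

lemma Problem.enorm_zero : D.enorm 0 = 0 := by
  have h : H10.grad (0 : H10 D.Ω) =ᵐ[volume.restrict D.Ω] 0 := Lp.coeFn_zero _ _ _
  have : D.a 0 0 = 0 := by
    rw [Problem.a]
    refine integral_eq_zero_of_ae ?_
    filter_upwards [h] with x hx
    rw [hx]
    simp
  rw [Problem.enorm, this, Real.sqrt_zero]

open Classical in
lemma Problem.eta_sq_inter_add_sdiff (𝒯 𝒯₁ 𝒯₂ : Mesh d) (v : H10 D.Ω) :
    D.eta 𝒯 (𝒯₁ ∩ 𝒯₂) v ^ 2 + D.eta 𝒯 (𝒯₁ \ 𝒯₂) v ^ 2 = D.eta 𝒯 𝒯₁ v ^ 2 := by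
  simp only [Problem.eta_sq]
  exact Finset.sum_inter_add_sum_sdiff 𝒯₁ 𝒯₂ _

open Classical in
/-- Reduction of the estimator under refinement, for a fixed discrete function. -/
lemma Problem.eta_sq_refinement_le {𝒯 𝒯' : Mesh d} {v : H10 D.Ω} {q : ℝ}
    (hstab : D.eta 𝒯' (𝒯' ∩ 𝒯) v = D.eta 𝒯 (𝒯' ∩ 𝒯) v)
    (hred : D.eta 𝒯' (𝒯' \ 𝒯) v ≤ q * D.eta 𝒯 (𝒯 \ 𝒯') v) :
    D.eta 𝒯' 𝒯' v ^ 2 ≤ D.eta 𝒯 𝒯 v ^ 2 - (1 - q ^ 2) * D.eta 𝒯 (𝒯 \ 𝒯') v ^ 2 := by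
  have h1 := D.eta_sq_inter_add_sdiff 𝒯' 𝒯' 𝒯 v
  have h2 := D.eta_sq_inter_add_sdiff 𝒯 𝒯 𝒯' v
  have h3 := pow_le_pow_left₀ (D.eta_nonneg _ _ v) hred 2
  rw [hstab, Finset.inter_comm] at h1
  rw [mul_pow] at h3
  linarith

/-- The constants in the estimator axioms in terms of an arbitrary norm that is equivalent to the
energy norm. -/
lemma Problem.EstimatorAxioms.exists_constants {p : ℕ} {𝒯₀ : Mesh d} {θ : ℝ}
    (hη : D.EstimatorAxioms p 𝒯₀) (hθ : 0 < θ) (hθ' : θ ≤ 1) {α β : ℝ} (hα : 0 < α) (hβ : 0 < β)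
    (heq : ∀ v : H10 D.Ω, α * ‖v‖ ≤ D.enorm v ∧ D.enorm v ≤ β * ‖v‖) :
    ∃ C q : ℝ, 0 < C ∧ 0 ≤ q ∧ q < 1 ∧
      (∀ 𝒯, NVBMesh 𝒯₀ 𝒯 → ∀ v ∈ feSpace D.Ω p 𝒯, ∀ w ∈ feSpace D.Ω p 𝒯,
        D.eta 𝒯 𝒯 v ≤ D.eta 𝒯 𝒯 w + C * ‖v - w‖) ∧
      (∀ 𝒯, NVBMesh 𝒯₀ 𝒯 → ∀ u uH, D.IsSolutionIn ⊤ u →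
        D.IsSolutionIn (feSpace D.Ω p 𝒯) uH → ‖u - uH‖ ≤ C * D.eta 𝒯 𝒯 uH) ∧
      (∀ 𝒯 𝒯' ℳ, NVBMesh 𝒯₀ 𝒯 → IsRefine 𝒯₀ 𝒯 ℳ 𝒯' → ℳ ⊆ 𝒯 → ∀ v ∈ feSpace D.Ω p 𝒯,
        θ * D.eta 𝒯 𝒯 v ^ 2 ≤ D.eta 𝒯 ℳ v ^ 2 → D.eta 𝒯' 𝒯' v ≤ q * D.eta 𝒯 𝒯 v) := by
  classical
  obtain ⟨Cs, Cr, q, hCs, hCr, hq0, hq1, hA1, hA2, hA3⟩ := hη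
  have hq2 : 0 < 1 - q ^ 2 := by nlinarith
  have hq3 : 1 - q ^ 2 ≤ 1 := by nlinarith
  have hρ1 : (1 - q ^ 2) * θ ≤ 1 := by nlinarith
  have hρ0 : 0 < (1 - q ^ 2) * θ := mul_pos hq2 hθ
  have hstep : ∀ 𝒯 𝒯', NVBMesh 𝒯₀ 𝒯 → NVBMesh 𝒯₀ 𝒯' → Bisects 𝒯 𝒯' → ∀ v ∈ feSpace D.Ω p 𝒯,
      D.eta 𝒯' 𝒯' v ^ 2 ≤ D.eta 𝒯 𝒯 v ^ 2 - (1 - q ^ 2) * D.eta 𝒯 (𝒯 \ 𝒯') v ^ 2 := by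
    intro 𝒯 𝒯' h h' hb v hv
    refine D.eta_sq_refinement_le ?_ (hA2 𝒯 𝒯' h h' hb v hv)
    -- Stability with equal arguments: the indicators on common elements do not change in total.
    have h1 := hA1 𝒯 𝒯' h h' hb v hv v (feSpace_mono hb hv)
    rw [sub_self, D.enorm_zero, mul_zero] at h1
    exact sub_eq_zero.1 (abs_eq_zero.1 (le_antisymm h1 (abs_nonneg _)))
  -- The contraction factor comes from reduction on the refined elements, which carry at least the
  -- fraction θ of the squared estimator.
  refine ⟨Cs * β + Cr / α, √(1 - (1 - q ^ 2) * θ), by positivity, Real.sqrt_nonneg _, ?_, ?_, ?_,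
    ?_⟩
  · rw [Real.sqrt_lt' one_pos]
    linarith
  · intro 𝒯 h v hv w hw
    have h1 := hA1 𝒯 𝒯 h h Relation.ReflTransGen.refl w hw v hv
    rw [Finset.inter_self] at h1
    have h2 := (le_abs_self _).trans h1
    have h3 := mul_le_mul_of_nonneg_left (heq (v - w)).2 hCs.le
    have h4 : 0 ≤ Cr / α * ‖v - w‖ := by positivity
    linarith
  · intro 𝒯 h u uH hu huH
    have h1 := ((heq _).1).trans (hA3 𝒯 h u uH hu huH)
    have h2 : ‖u - uH‖ ≤ Cr / α * D.eta 𝒯 𝒯 uH := by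
      rw [div_mul_eq_mul_div, le_div_iff₀ hα]
      linarith
    have h3 : 0 ≤ Cs * β * D.eta 𝒯 𝒯 uH := mul_nonneg (by positivity) (D.eta_nonneg _ _ _)
    linarith
  · intro 𝒯 𝒯' ℳ h hr hsub v hv hmark
    have h1 := hstep 𝒯 𝒯' h hr.mesh hr.bisects v hv
    -- Marked elements are absent from the refinement, so they count among the refined ones.
    have h2 : D.eta 𝒯 ℳ v ^ 2 ≤ D.eta 𝒯 (𝒯 \ 𝒯') v ^ 2 := by
      rw [D.eta_sq, D.eta_sq]
      refine Finset.sum_le_sum_of_subset_of_nonneg (fun T hT => Finset.mem_sdiff.2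
        ⟨hsub hT, Finset.disjoint_left.1 hr.refined hT⟩) fun T _ _ => D.etaSq_nonneg 𝒯 T v
    have h3 := mul_le_mul_of_nonneg_left (hmark.trans h2) hq2.le
    refine le_of_sq_le_sq ?_ (mul_nonneg (Real.sqrt_nonneg _) (D.eta_nonneg _ _ _))
    rw [mul_pow, Real.sq_sqrt (by linarith)]
    linarith

end Estimator

/-! ### A priori convergence of Galerkin approximations -/

section Galerkin

variable {V : Type*} [NormedAddCommGroup V] [InnerProductSpace ℝ V]

lemma exists_bound_bilin (A : V →L[ℝ] V →L[ℝ] ℝ) :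
    ∃ M, 0 < M ∧ ∀ v w, A v w ≤ M * ‖v‖ * ‖w‖ := by
  refine ⟨‖A‖ + 1, by positivity, fun v w => ?_⟩
  refine (le_abs_self _).trans ((A.le_opNorm₂ v w).trans ?_)
  gcongr
  linarith

/-- Quasi-optimality of Galerkin approximations. -/
lemma norm_sub_le_of_galerkin {A : V →L[ℝ] V →L[ℝ] ℝ} {α M : ℝ} (hα : 0 < α)
    (hM : 0 < M) (hA : ∀ v, α * ‖v‖ ^ 2 ≤ A v v) (hAM : ∀ v w, A v w ≤ M * ‖v‖ * ‖w‖)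
    {X : Submodule ℝ V} {u uX : V} (hX : uX ∈ X)
    (horth : ∀ v ∈ X, A uX v = A u v) {v : V} (hv : v ∈ X) :
    ‖u - uX‖ ≤ M / α * ‖u - v‖ := by
  have h1 : A (u - uX) (u - uX) = A (u - uX) (u - v) := by
    have h2 : A (u - uX) (uX - v) = 0 := by
      rw [map_sub A, _root_.sub_apply, horth _ (X.sub_mem hX hv), sub_self]
    have h3 : A (u - uX) (u - v) = A (u - uX) (u - uX) + A (u - uX) (uX - v) := by
      rw [← map_add, sub_add_sub_cancel]
    rw [h3, h2, add_zero]
  have h2 := hA (u - uX)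
  have h3 := hAM (u - uX) (u - v)
  rw [← h1] at h3
  rcases (norm_nonneg (u - uX)).eq_or_lt with h4 | h4
  · rw [← h4]; positivity
  · rw [div_mul_eq_mul_div, le_div_iff₀ hα]
    refine le_of_mul_le_mul_right ?_ h4
    nlinarith

/-- Here the discrete difference uX - v is itself an admissible test function. This bounds the
algebraic error of a discrete function by its total error. -/
lemma norm_galerkin_sub_le {A : V →L[ℝ] V →L[ℝ] ℝ} {α M : ℝ} (hα : 0 < α)
    (hM : 0 < M) (hA : ∀ v, α * ‖v‖ ^ 2 ≤ A v v) (hAM : ∀ v w, A v w ≤ M * ‖v‖ * ‖w‖)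
    {X : Submodule ℝ V} {u uX : V} (hX : uX ∈ X)
    (horth : ∀ v ∈ X, A uX v = A u v) {v : V} (hv : v ∈ X) :
    ‖uX - v‖ ≤ M / α * ‖u - v‖ := by
  have h1 : A (uX - v) (uX - v) = A (u - v) (uX - v) := by
    have := horth _ (X.sub_mem hX hv)
    simp only [map_sub, _root_.sub_apply] at *
    linarith
  have h2 := hA (uX - v)
  have h3 := hAM (u - v) (uX - v)
  rw [← h1] at h3
  rcases (norm_nonneg (uX - v)).eq_or_lt with h4 | h4
  · rw [← h4]; positivity
  · rw [div_mul_eq_mul_div, le_div_iff₀ hα]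
    refine le_of_mul_le_mul_right ?_ h4
    nlinarith

/-- The Lax-Milgram theorem on a complete subspace. -/
lemma exists_galerkin {A : V →L[ℝ] V →L[ℝ] ℝ} {α : ℝ} (hα : 0 < α)
    (hA : ∀ v, α * ‖v‖ ^ 2 ≤ A v v) (W : Submodule ℝ V) [CompleteSpace W] (u : V) :
    ∃ w ∈ W, ∀ v ∈ W, A w v = A u v := by
  have hco : IsCoercive (A.bilinearComp W.subtypeL W.subtypeL) :=
    ⟨α, hα, fun v => by simpa [pow_two, mul_assoc] using hA (v : V)⟩
  set f : W := (InnerProductSpace.toDual ℝ W).symm ((A u).comp W.subtypeL)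
  refine ⟨hco.continuousLinearEquivOfBilin.symm f, Submodule.coe_mem _, fun v hv => ?_⟩
  have h := hco.continuousLinearEquivOfBilin_apply (hco.continuousLinearEquivOfBilin.symm f)
    ⟨v, hv⟩
  rw [ContinuousLinearEquiv.apply_symm_apply] at h
  have h' : inner ℝ f ⟨v, hv⟩ = A u v := by
    simp [f, InnerProductSpace.toDual_symm_apply]
  rw [h'] at h
  exact h.symm

/-- Galerkin approximations in nested spaces converge. -/
theorem exists_tendsto_galerkin [CompleteSpace V] {A : V →L[ℝ] V →L[ℝ] ℝ} {α : ℝ} (hα : 0 < α)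
    (hA : ∀ v, α * ‖v‖ ^ 2 ≤ A v v) {X : ℕ → Submodule ℝ V} (hX : Monotone X) {u : V}
    {uX : ℕ → V} (huX : ∀ n, uX n ∈ X n) (horth : ∀ n, ∀ v ∈ X n, A (uX n) v = A u v) :
    ∃ w, Tendsto uX atTop (𝓝 w) := by
  -- The limit is the Galerkin solution w in the closure of the union, in general not u. Each `uX n`
  -- is also the Galerkin approximation of w, and w is approximable by discrete functions, so
  -- quasi-optimality applies.
  set W : Submodule ℝ V := (⨆ n, X n).topologicalClosure with hW
  have : CompleteSpace W := (Submodule.isClosed_topologicalClosure _).completeSpace_coe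
  obtain ⟨w, hw, hwA⟩ := exists_galerkin hα hA W u
  have hXW : ∀ n, X n ≤ W := fun n => (le_iSup X n).trans (Submodule.le_topologicalClosure _)
  refine ⟨w, Metric.tendsto_atTop.2 fun ε hε => ?_⟩
  obtain ⟨M, hM, hAM⟩ := exists_bound_bilin A
  have hC : 0 < M / α := by positivity
  obtain ⟨v, hv, hvw⟩ := Metric.mem_closure_iff.1 (show w ∈ closure ((⨆ n, X n : Submodule ℝ V) :
    Set V) from hw) (ε / (M / α)) (by positivity)
  obtain ⟨n, hn⟩ := (Submodule.mem_iSup_of_directed X hX.directed_le).1 hv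
  refine ⟨n, fun m hm => ?_⟩
  have h1 := norm_sub_le_of_galerkin hα hM hA hAM (huX m)
    (fun y hy => (horth m y hy).trans (hwA y (hXW m hy)).symm) (hX hm hn)
  rw [dist_eq_norm] at hvw
  rw [dist_comm, dist_eq_norm]
  calc ‖w - uX m‖ ≤ M / α * ‖w - v‖ := h1
    _ < (M / α) * (ε / (M / α)) := by gcongr
    _ = ε := by field_simp

end Galerkin

/-! ### Real sequences -/

/-- A perturbed contraction with vanishing perturbation converges to zero. -/
lemma tendsto_zero_of_perturbed_contraction {x y : ℕ → ℝ} {q : ℝ} (hq0 : 0 ≤ q) (hq1 : q < 1)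
    (hx : ∀ n, 0 ≤ x n) (hy : Tendsto y atTop (𝓝 0))
    (h : ∀ᶠ n in atTop, x (n + 1) ≤ q * x n + y n) : Tendsto x atTop (𝓝 0) := by
  rw [Metric.tendsto_atTop]
  intro ε hε
  -- With this threshold the bound ε/2 reproduces itself: q · ε/2 + (1 - q) · ε/2 = ε/2.
  have h1 : ∀ᶠ n in atTop, y n < (1 - q) * (ε / 2) :=
    hy.eventually_lt_const (mul_pos (by linarith) (by linarith))
  obtain ⟨L, hL⟩ := eventually_atTop.1 (h.and h1)
  have h2 : ∀ n, x (L + n) ≤ ε / 2 + q ^ n * x L := by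
    intro n
    induction n with
    | zero => simp only [add_zero, pow_zero, one_mul]; linarith
    | succ n ih =>
      have h3 := hL (L + n) (by omega)
      have h4 := mul_le_mul_of_nonneg_left ih hq0
      rw [← add_assoc, pow_succ]
      linarith [h3.1, h3.2]
  have h3 : Tendsto (fun n => q ^ n * x L) atTop (𝓝 0) := by
    simpa using (tendsto_pow_atTop_nhds_zero_of_lt_one hq0 hq1).mul_const (x L)
  obtain ⟨M, hM⟩ := eventually_atTop.1 (h3.eventually_lt_const (half_pos hε))
  refine ⟨L + M, fun n hn => ?_⟩
  obtain ⟨m, rfl⟩ := Nat.exists_eq_add_of_le (le_of_add_le_left hn)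
  rw [Real.dist_eq, sub_zero, abs_of_nonneg (hx _)]
  linarith [h2 m, hM m (by omega)]

/-- A nonnegative sequence that is halved infinitely often and constant otherwise. -/
lemma tendsto_zero_of_frequently_half {l : ℕ → ℝ} {U : ℕ → Prop} (h0 : 0 < l 0)
    (hU : ∀ n, U n → l (n + 1) = l n / 2) (hU' : ∀ n, ¬ U n → l (n + 1) = l n)
    (hfreq : ∃ᶠ n in atTop, U n) : Tendsto l atTop (𝓝 0) := by
  have hpos : ∀ n, 0 < l n := by
    intro n
    induction n with
    | zero => exact h0
    | succ n ih =>
      by_cases h : U n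
      · rw [hU n h]; linarith
      · rw [hU' n h]; exact ih
  have hanti : Antitone l := antitone_nat_of_succ_le fun n => by
    by_cases h : U n
    · rw [hU n h]; linarith [hpos n]
    · rw [hU' n h]
  have hle : ∀ m : ℕ, ∃ n, l n ≤ (1 / 2) ^ m * l 0 := by
    intro m
    induction m with
    | zero => exact ⟨0, by simp⟩
    | succ m ih =>
      obtain ⟨n, hn⟩ := ih
      obtain ⟨k, hk, hUk⟩ := frequently_atTop.1 hfreq n
      refine ⟨k + 1, ?_⟩
      rw [hU k hUk, pow_succ]
      linarith [hanti hk]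
  rw [Metric.tendsto_atTop]
  intro ε hε
  have h3 : Tendsto (fun m : ℕ => (1 / 2 : ℝ) ^ m * l 0) atTop (𝓝 0) := by
    simpa using (tendsto_pow_atTop_nhds_zero_of_lt_one (r := (1 / 2 : ℝ)) (by norm_num)
      (by norm_num)).mul_const (l 0)
  obtain ⟨m, hm⟩ := (h3.eventually_lt_const hε).exists
  obtain ⟨n, hn⟩ := hle m
  refine ⟨n, fun k hk => ?_⟩
  rw [Real.dist_eq, sub_zero, abs_of_pos (hpos k)]
  linarith [hanti hk]

/-- If the partial sums of the reciprocals of `H` are controlled by the last reciprocal, then `H`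
tends to zero. -/
lemma tendsto_zero_of_sum_inv_le {H : ℕ → ℝ} {S : ℕ → ℝ≥0∞} {c : ℝ} (hc : 0 < c) {L : ℕ}
    (hH : ∀ n, 0 ≤ H n) (hS : ∀ n, S (n + 1) = S n + (ENNReal.ofReal (H n))⁻¹)
    (hle : ∀ n, L ≤ n → S n ≤ ENNReal.ofReal c * (ENNReal.ofReal (H n))⁻¹) :
    Tendsto H atTop (𝓝 0) := by
  have hc0 : ENNReal.ofReal c ≠ 0 := by simpa using hc
  have hmono : Monotone S := monotone_nat_of_le_succ fun n => by rw [hS]; exact le_self_add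
  -- A positive lower bound for all later reciprocals, hence linear growth of S. The index is L + 1
  -- since S L may vanish, whereas `S (L + 1)` contains the nonzero reciprocal of `H L`. Values H =
  -- 0 need no separate treatment in the extended reals.
  set δ := S (L + 1) / ENNReal.ofReal c with hδ
  have hδ0 : δ ≠ 0 := by
    rw [hδ, ENNReal.div_ne_zero, hS]
    refine ⟨fun h => ?_, ENNReal.ofReal_ne_top⟩
    have := (add_eq_zero.1 h).2
    simp at this
  have hδle : ∀ n, L + 1 ≤ n → δ ≤ (ENNReal.ofReal (H n))⁻¹ := fun n hn =>
    ENNReal.div_le_of_le_mul' ((hmono hn).trans (hle n (by omega)))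
  have hSge : ∀ m : ℕ, (m : ℝ≥0∞) * δ ≤ S (L + 1 + m) := by
    intro m
    induction m with
    | zero => simp
    | succ m ih =>
      rw [← add_assoc, hS, Nat.cast_succ, add_mul, one_mul]
      exact add_le_add ih (hδle _ (by omega))
  rw [Metric.tendsto_atTop]
  intro ε hε
  obtain ⟨m, hm⟩ := ENNReal.exists_nat_mul_gt hδ0
    (show ENNReal.ofReal c * (ENNReal.ofReal ε)⁻¹ ≠ ⊤ from
      ENNReal.mul_ne_top ENNReal.ofReal_ne_top (by simpa using hε))
  refine ⟨L + 1 + m, fun n hn => ?_⟩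
  rw [Real.dist_eq, sub_zero, abs_of_nonneg (hH n)]
  by_contra hge
  rw [not_lt] at hge
  have h1 := (hSge m).trans ((hmono hn).trans (hle n (by omega)))
  have h2 : (ENNReal.ofReal (H n))⁻¹ ≤ (ENNReal.ofReal ε)⁻¹ :=
    ENNReal.inv_le_inv.2 (ENNReal.ofReal_le_ofReal hge)
  exact absurd (h1.trans (mul_le_mul_right h2 _)) (not_le.2 hm)

/-! ### The algebraic solver on one level -/

lemma precNorm_nonneg {N : ℕ} {P : Matrix (Fin N) (Fin N) ℝ} (a : Fin N → ℝ) :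
    0 ≤ precNorm P a := Real.sqrt_nonneg _

/-- Cauchy–Schwarz, from the nonnegative square of ‖b‖² a - (a, b) b. -/
lemma precInner_le_mul {N : ℕ} {P : Matrix (Fin N) (Fin N) ℝ} (hP : P.PosDef)
    (a b : Fin N → ℝ) : precInner P a b ≤ precNorm P a * precNorm P b := by
  by_cases hb : precNorm P b = 0
  · rw [eq_zero_of_precNorm_eq_zero hP hb, precInner_zero_right, precNorm_zero, mul_zero]
  · have hb' : 0 < precNorm P b := (Real.sqrt_nonneg _).lt_of_ne' hb
    refine (le_of_abs_le (abs_le_of_sq_le_sq ?_ (mul_nonneg (Real.sqrt_nonneg _) hb'.le)))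
    have h1 := precInner_self_nonneg hP
      (precNorm P b ^ 2 • a - precInner P a b • b)
    simp only [precInner_sub_left, precInner_sub_right, precInner_smul_left,
      precInner_smul_right, precInner_comm hP b a] at h1
    simp only [← precNorm_sq hP] at h1
    rw [mul_pow]
    refine le_of_mul_le_mul_left ?_ (pow_pos hb' 2)
    linarith

lemma le_div_mul_of_mul_sq_le {a b e t : ℝ} (ha : 0 < a) (hb : 0 ≤ b) (ht : 0 ≤ t)
    (h : a * e ^ 2 ≤ t * (b * e)) : e ≤ b / a * t := by
  rcases le_or_gt e 0 with h7 | h7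
  · exact h7.trans (by positivity)
  · rw [div_mul_eq_mul_div, le_div_iff₀ ha]
    refine le_of_mul_le_mul_right ?_ h7
    linarith

lemma mul_mul_le_of_le_div {a b a' b' γ μ m : ℝ} (hγ : 0 < γ) (hμ : 0 ≤ μ) (hm : 0 ≤ m)
    (ha' : 0 ≤ a') (hb' : 0 ≤ b') (hb : 0 ≤ b) (h1 : a ≤ a' / γ) (h2 : b ≤ b' / γ) :
    μ * a * b ≤ (μ / γ ^ 2 + m) * a' * b' :=
  calc μ * a * b ≤ μ * (a' / γ) * (b' / γ) := by gcongr
    _ = μ / γ ^ 2 * a' * b' := by ring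
    _ ≤ (μ / γ ^ 2 + m) * a' * b' := by
        gcongr
        linarith

/-- One step of a residual minimization for a coercive and bounded operator. -/
lemma exists_precNorm_sub_smul_le {N : ℕ} {B P : Matrix (Fin N) (Fin N) ℝ} (hP : P.PosDef)
    {m M : ℝ} (hm : 0 < m) (hmM : m ≤ M) (hco : ∀ s, m * precNorm P s ^ 2 ≤ (B *ᵥ s) ⬝ᵥ s)
    (hbd : ∀ s z, (B *ᵥ s) ⬝ᵥ z ≤ M * precNorm P s * precNorm P z) (s : Fin N → ℝ) :
    precNorm P (s - (m / M ^ 2) • (P *ᵥ (B *ᵥ s))) ≤ √(1 - m ^ 2 / M ^ 2) * precNorm P s := by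
  have hM : 0 < M := hm.trans_le hmM
  have hq : 0 ≤ 1 - m ^ 2 / M ^ 2 := by
    rw [sub_nonneg, div_le_one (by positivity)]
    exact pow_le_pow_left₀ hm.le hmM 2
  -- Expanding the square for a step size t gives the factor 1 - 2tm + t²M², which is minimal for t
  -- = m / M².
  refine le_of_sq_le_sq ?_ (mul_nonneg (Real.sqrt_nonneg _) (Real.sqrt_nonneg _))
  rw [mul_pow, Real.sq_sqrt hq, precNorm_sq hP]
  have h1 : precInner P (P *ᵥ (B *ᵥ s)) s = (B *ᵥ s) ⬝ᵥ s := precInner_mulVec_left hP _ _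
  have h2 : precNorm P (P *ᵥ (B *ᵥ s)) ≤ M * precNorm P s := by
    -- Boundedness tested with z = P B s; one factor of its norm cancels.
    have h3 := hbd s (P *ᵥ (B *ᵥ s))
    rw [← precInner_mulVec_left hP, ← precNorm_sq hP] at h3
    rcases (precNorm_nonneg (P := P) (P *ᵥ (B *ᵥ s))).eq_or_lt with h4 | h4
    · rw [← h4]; exact mul_nonneg hM.le (Real.sqrt_nonneg _)
    · refine le_of_mul_le_mul_right ?_ h4
      linarith
  have h5 := pow_le_pow_left₀ (precNorm_nonneg _) h2 2
  have h6 := hco s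
  simp only [precInner_sub_left, precInner_sub_right, precInner_smul_left,
      precInner_smul_right, precInner_comm hP s (P *ᵥ (B *ᵥ s)), h1]
  simp only [← precNorm_sq hP]
  have h7 : (m / M ^ 2) * (m / M ^ 2) * precNorm P (P *ᵥ (B *ᵥ s)) ^ 2 ≤
      (m / M ^ 2) * (m / M ^ 2) * (M * precNorm P s) ^ 2 :=
    mul_le_mul_of_nonneg_left h5 (by positivity)
  have h8 : (m / M ^ 2) * (m * precNorm P s ^ 2) ≤ (m / M ^ 2) * ((B *ᵥ s) ⬝ᵥ s) :=
    mul_le_mul_of_nonneg_left h6 (by positivity)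
  have h9 : (m / M ^ 2) * (m / M ^ 2) * (M * precNorm P s) ^ 2 =
      m ^ 2 / M ^ 2 * precNorm P s ^ 2 := by field_simp
  have h10 : (m / M ^ 2) * (m * precNorm P s ^ 2) = m ^ 2 / M ^ 2 * precNorm P s ^ 2 := by ring
  linarith

namespace Iteration

variable {d : ℕ} {D : Problem d} {p : ℕ} (R : Iteration D p)

lemma fn_mem (ℓ : ℕ) (y : Fin (R.N ℓ) → ℝ) : R.fn ℓ y ∈ feSpace D.Ω p (R.mesh ℓ) :=
  Submodule.sum_mem _ fun j _ => Submodule.smul_mem _ _ (R.basis ℓ j).2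

lemma exists_fn_eq {ℓ : ℕ} {v : H10 D.Ω} (hv : v ∈ feSpace D.Ω p (R.mesh ℓ)) :
    ∃ y, R.fn ℓ y = v := by
  refine ⟨(R.basis ℓ).repr ⟨v, hv⟩, ?_⟩
  have h := congrArg (Subtype.val) ((R.basis ℓ).sum_repr ⟨v, hv⟩)
  rw [Submodule.coe_sum] at h
  exact h

lemma B_mulVec_dotProduct {A : H10 D.Ω →L[ℝ] H10 D.Ω →L[ℝ] ℝ} (hA : ∀ v w, A v w = D.form v w)
    (ℓ : ℕ) (y z : Fin (R.N ℓ) → ℝ) : (R.B ℓ *ᵥ y) ⬝ᵥ z = A (R.fn ℓ y) (R.fn ℓ z) := by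
  simp only [fn, map_sum, map_smul, _root_.sum_apply, _root_.smul_apply, smul_eq_mul,
    mulVec, dotProduct, B, ← hA, Finset.sum_mul, Finset.mul_sum]
  exact Finset.sum_congr rfl fun i _ => Finset.sum_congr rfl fun j _ => by ring

/-- The algebraic residual represents the form applied to the algebraic error. -/
lemma residual_dotProduct {A : H10 D.Ω →L[ℝ] H10 D.Ω →L[ℝ] ℝ} (hA : ∀ v w, A v w = D.form v w)
    {ℓ : ℕ} {uL : H10 D.Ω} (huL : D.IsSolutionIn (feSpace D.Ω p (R.mesh ℓ)) uL) (k : ℕ)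
    (z : Fin (R.N ℓ) → ℝ) :
    (R.load ℓ - R.B ℓ *ᵥ R.x ℓ k) ⬝ᵥ z = A (uL - R.u ℓ k) (R.fn ℓ z) := by
  rw [sub_dotProduct, R.B_mulVec_dotProduct hA, map_sub, _root_.sub_apply]
  congr 1
  simp only [fn, map_sum, map_smul, smul_eq_mul, dotProduct, load]
  exact Finset.sum_congr rfl fun i _ => by rw [hA, huL.2 _ (R.basis ℓ i).2, mul_comm]

lemma resNorm_nonneg (ℓ k : ℕ) : 0 ≤ R.resNorm ℓ k := Real.sqrt_nonneg _

lemma mem_Q_of_le {ℓ j k : ℕ} (h : (ℓ, k) ∈ R.Q) (hjk : j ≤ k) : (ℓ, j) ∈ R.Q :=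
  ⟨h.1, fun i h1 h2 => h.2 i h1 (lt_of_lt_of_le h2 hjk)⟩

/-- Test the residual identity with the coefficients of the algebraic error; then coercivity,
Cauchy–Schwarz and cancellation. The converse, `resNorm_le_error`, tests with the preconditioned
residual itself. -/
lemma norm_error_le {A : H10 D.Ω →L[ℝ] H10 D.Ω →L[ℝ] ℝ} {α Γ : ℝ} (hα : 0 < α)
    (hΓ : 0 < Γ) (hA : ∀ v w, A v w = D.form v w) (hco : ∀ v, α * ‖v‖ ^ 2 ≤ A v v) {ℓ : ℕ}
    (hP : (R.P ℓ).PosDef) (hup : ∀ y, precNorm (R.P ℓ) y ≤ Γ * ‖R.fn ℓ y‖) {uL : H10 D.Ω}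
    (huL : D.IsSolutionIn (feSpace D.Ω p (R.mesh ℓ)) uL) (k : ℕ) :
    ‖uL - R.u ℓ k‖ ≤ Γ / α * R.resNorm ℓ k := by
  have hmem : uL - R.u ℓ k ∈ feSpace D.Ω p (R.mesh ℓ) :=
    Submodule.sub_mem _ huL.1 (R.fn_mem ℓ _)
  obtain ⟨z, hz⟩ := R.exists_fn_eq hmem
  have h1 := R.residual_dotProduct hA huL k z
  rw [← precInner_mulVec_left hP, hz] at h1
  have h2 := precInner_le_mul hP (R.P ℓ *ᵥ (R.load ℓ - R.B ℓ *ᵥ R.x ℓ k)) z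
  rw [h1] at h2
  have h3 := hco (uL - R.u ℓ k)
  have h4 := hup z
  rw [hz] at h4
  have h5 : α * ‖uL - R.u ℓ k‖ ^ 2 ≤ R.resNorm ℓ k * (Γ * ‖uL - R.u ℓ k‖) :=
    h3.trans (h2.trans (mul_le_mul_of_nonneg_left h4 (R.resNorm_nonneg ℓ k)))
  exact le_div_mul_of_mul_sq_le hα hΓ.le (R.resNorm_nonneg ℓ k) h5

lemma resNorm_le_error {A : H10 D.Ω →L[ℝ] H10 D.Ω →L[ℝ] ℝ} {γ μ : ℝ}
    (hγ : 0 < γ) (hμ : 0 < μ) (hA : ∀ v w, A v w = D.form v w)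
    (hbd : ∀ v w, A v w ≤ μ * ‖v‖ * ‖w‖) {ℓ : ℕ} (hP : (R.P ℓ).PosDef)
    (hlow : ∀ y, ‖R.fn ℓ y‖ ≤ precNorm (R.P ℓ) y / γ) {uL : H10 D.Ω}
    (huL : D.IsSolutionIn (feSpace D.Ω p (R.mesh ℓ)) uL) (k : ℕ) :
    R.resNorm ℓ k ≤ μ / γ * ‖uL - R.u ℓ k‖ := by
  have hres : R.resNorm ℓ k = precNorm (R.P ℓ) (R.P ℓ *ᵥ (R.load ℓ - R.B ℓ *ᵥ R.x ℓ k)) := rfl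
  have h1 := R.residual_dotProduct hA huL k (R.P ℓ *ᵥ (R.load ℓ - R.B ℓ *ᵥ R.x ℓ k))
  rw [← precInner_mulVec_left hP, ← precNorm_sq hP, ← hres] at h1
  have h2 := hbd (uL - R.u ℓ k) (R.fn ℓ (R.P ℓ *ᵥ (R.load ℓ - R.B ℓ *ᵥ R.x ℓ k)))
  rw [← h1] at h2
  have h3 := mul_le_mul_of_nonneg_left (hlow (R.P ℓ *ᵥ (R.load ℓ - R.B ℓ *ᵥ R.x ℓ k)))
    (mul_nonneg hμ.le (norm_nonneg (uL - R.u ℓ k)))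
  rw [← hres] at h3
  refine le_div_mul_of_mul_sq_le hγ hμ.le (norm_nonneg _) ?_
  have h4 := mul_le_mul_of_nonneg_left (h2.trans h3) hγ.le
  refine h4.trans_eq ?_
  rw [mul_comm γ, mul_assoc, div_mul_cancel₀ _ hγ.ne', mul_comm μ, mul_assoc]

/-- Contraction of the preconditioned residual between two restarts of GMRES. -/
lemma resNorm_le_mul_resNorm_start {A : H10 D.Ω →L[ℝ] H10 D.Ω →L[ℝ] ℝ} {α γ Γ μ : ℝ}
    (hα : 0 < α) (hγ : 0 < γ) (hΓ : 0 < Γ) (hμ : 0 < μ) (hA : ∀ v w, A v w = D.form v w)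
    (hco : ∀ v, α * ‖v‖ ^ 2 ≤ A v v) (hbd : ∀ v w, A v w ≤ μ * ‖v‖ * ‖w‖) {ℓ : ℕ}
    (hP : (R.P ℓ).PosDef) (hlow : ∀ y, ‖R.fn ℓ y‖ ≤ precNorm (R.P ℓ) y / γ)
    (hup : ∀ y, precNorm (R.P ℓ) y ≤ Γ * ‖R.fn ℓ y‖) {kmax : ℕ} (hkmax : 1 ≤ kmax)
    (hinit : IsGMRESInit (R.B ℓ) (R.P ℓ) (R.load ℓ) (R.x ℓ) (R.v ℓ) (R.vt ℓ)) {k : ℕ}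
    (hk : 1 ≤ k) (hstep : ∀ j, 1 ≤ j → j ≤ k →
      IsGMRESStep (R.B ℓ) (R.P ℓ) (R.load ℓ) kmax (R.x ℓ) (R.v ℓ) (R.vt ℓ) j) :
    R.resNorm ℓ k ≤ √(1 - (α / Γ ^ 2) ^ 2 / (μ / γ ^ 2 + α / Γ ^ 2) ^ 2) *
      R.resNorm ℓ (gmresStart kmax k) := by
  have hm0 : 0 < α / Γ ^ 2 := by positivity
  -- The coercivity constant is added to the bound μ/γ² solely to ensure m ≤ M.
  have hmM : α / Γ ^ 2 ≤ μ / γ ^ 2 + α / Γ ^ 2 := by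
    have : 0 ≤ μ / γ ^ 2 := by positivity
    linarith
  refine (gmres_residual_le hP hkmax hinit hk hstep
    (α / Γ ^ 2 / (μ / γ ^ 2 + α / Γ ^ 2) ^ 2)).trans ?_
  refine exists_precNorm_sub_smul_le hP hm0 hmM (fun s => ?_) (fun s z => ?_) _
  · rw [R.B_mulVec_dotProduct hA]
    refine le_trans ?_ (hco _)
    have h1 := pow_le_pow_left₀ (precNorm_nonneg _) (hup s) 2
    rw [div_mul_eq_mul_div, div_le_iff₀ (by positivity)]
    have h2 := mul_le_mul_of_nonneg_left h1 hα.le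
    have h3 : α * (Γ * ‖R.fn ℓ s‖) ^ 2 = α * ‖R.fn ℓ s‖ ^ 2 * Γ ^ 2 := by ring
    rw [← h3]
    exact h2
  · rw [R.B_mulVec_dotProduct hA]
    refine (hbd _ _).trans ?_
    have h1 := hlow s
    have h2 := hlow z
    have h3 : 0 ≤ precNorm (R.P ℓ) s := precNorm_nonneg s
    have h4 : 0 ≤ precNorm (R.P ℓ) z := precNorm_nonneg z
    exact mul_mul_le_of_le_div hγ hμ.le hm0.le h3 h4 (norm_nonneg _) h1 h2

lemma OptimalPreconditioner.exists_norm_equiv {R : Iteration D p} (hP : R.OptimalPreconditioner)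
    {α β : ℝ} (hα : 0 < α) (hβ : 0 < β)
    (heq : ∀ v : H10 D.Ω, α * ‖v‖ ≤ D.enorm v ∧ D.enorm v ≤ β * ‖v‖) :
    ∃ γ Γ : ℝ, 0 < γ ∧ 0 < Γ ∧ ∀ ℓ, R.Reached ℓ → (R.P ℓ).PosDef ∧
      (∀ y, ‖R.fn ℓ y‖ ≤ precNorm (R.P ℓ) y / γ) ∧
      ∀ y, precNorm (R.P ℓ) y ≤ Γ * ‖R.fn ℓ y‖ := by
  obtain ⟨Cpre, hCpre, hpre⟩ := hP
  have hC0 : 0 < Cpre := by linarith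
  refine ⟨α / Cpre, Cpre * β, by positivity, by positivity, fun ℓ hℓ =>
    ⟨(hpre ℓ hℓ).1, fun y => ?_, fun y => ?_⟩⟩
  · have h1 := ((hpre ℓ hℓ).2 y).1
    have h2 := mul_le_mul_of_nonneg_left (heq (R.fn ℓ y)).1 (inv_nonneg.2 hC0.le)
    rw [le_div_iff₀ (by positivity), div_eq_inv_mul]
    linarith
  · have h1 := ((hpre ℓ hℓ).2 y).2
    have h2 := mul_le_mul_of_nonneg_left (heq (R.fn ℓ y)).2 hC0.le
    linarith

/-- Uniform equivalence of residual and algebraic error, and contraction of restarted GMRES. -/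
theorem exists_solver_constants {A : H10 D.Ω →L[ℝ] H10 D.Ω →L[ℝ] ℝ} {α β μ : ℝ} (hα : 0 < α)
    (hβ : 0 < β) (hμ : 0 < μ) (hA : ∀ v w, A v w = D.form v w)
    (hco : ∀ v, α * ‖v‖ ^ 2 ≤ A v v) (hbd : ∀ v w, A v w ≤ μ * ‖v‖ * ‖w‖)
    (heq : ∀ v : H10 D.Ω, α * ‖v‖ ≤ D.enorm v ∧ D.enorm v ≤ β * ‖v‖)
    {𝒯₀ : Mesh d} {θ Cmark Calg lam : ℝ} {kmax : ℕ} (hkmax : 1 ≤ kmax) {u₀ : H10 D.Ω}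
    (hR : R.IsGenerated 𝒯₀ θ Cmark Calg lam kmax u₀) (hP : R.OptimalPreconditioner)
    {uL : ℕ → H10 D.Ω}
    (huL : ∀ ℓ, R.Reached ℓ → D.IsSolutionIn (feSpace D.Ω p (R.mesh ℓ)) (uL ℓ)) :
    ∃ C q : ℝ, 0 < C ∧ 0 ≤ q ∧ q < 1 ∧
      (∀ ℓ k, R.Reached ℓ → ‖uL ℓ - R.u ℓ k‖ ≤ C * R.resNorm ℓ k) ∧
      (∀ ℓ k, R.Reached ℓ → R.resNorm ℓ k ≤ C * ‖uL ℓ - R.u ℓ k‖) ∧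
      (∀ ℓ k, (ℓ, k) ∈ R.Q → 1 ≤ k →
        R.resNorm ℓ k ≤ q * R.resNorm ℓ (gmresStart kmax k)) := by
  obtain ⟨γ, Γ, hγ, hΓ, hpre⟩ := hP.exists_norm_equiv hα hβ heq
  refine ⟨max (Γ / α) (μ / γ), √(1 - (α / Γ ^ 2) ^ 2 / (μ / γ ^ 2 + α / Γ ^ 2) ^ 2),
    lt_max_of_lt_left (by positivity), Real.sqrt_nonneg _, ?_, fun ℓ k hℓ => ?_,
    fun ℓ k hℓ => ?_, fun ℓ k hk hk1 => ?_⟩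
  · rw [Real.sqrt_lt' one_pos]
    have : 0 < (α / Γ ^ 2) ^ 2 / (μ / γ ^ 2 + α / Γ ^ 2) ^ 2 := by positivity
    linarith
  · obtain ⟨hPℓ, -, hup⟩ := hpre ℓ hℓ
    exact (R.norm_error_le hα hΓ hA hco hPℓ hup (huL ℓ hℓ) k).trans
      (mul_le_mul_of_nonneg_right (le_max_left _ _) (R.resNorm_nonneg ℓ k))
  · obtain ⟨hPℓ, hlow, -⟩ := hpre ℓ hℓ
    exact (R.resNorm_le_error hγ hμ hA hbd hPℓ hlow (huL ℓ hℓ) k).trans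
      (mul_le_mul_of_nonneg_right (le_max_right _ _) (norm_nonneg _))
  · obtain ⟨hPℓ, hlow, hup⟩ := hpre ℓ hk.1
    exact R.resNorm_le_mul_resNorm_start hα hγ hΓ hμ hA hco hbd hPℓ hlow hup hkmax
      (hR.solve_init ℓ hk.1) hk1
      fun j h1 h2 => hR.solve_step ℓ j (R.mem_Q_of_le hk h2) h1

lemma resNorm_le_pow {q : ℝ} (hq0 : 0 ≤ q) {kmax : ℕ} {ℓ : ℕ}
    (hq : ∀ k, (ℓ, k) ∈ R.Q → 1 ≤ k → R.resNorm ℓ k ≤ q * R.resNorm ℓ (gmresStart kmax k))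
    (hkmax : 1 ≤ kmax) :
    ∀ m, (ℓ, m * kmax) ∈ R.Q → R.resNorm ℓ (m * kmax) ≤ q ^ m * R.resNorm ℓ 0 := by
  intro m
  induction m with
  | zero => simp
  | succ m ih =>
    intro hm
    have h1 : (m + 1) * kmax = m * kmax + kmax := by ring
    have h2 := hq _ hm (by rw [h1]; omega)
    rw [h1, gmresStart_add hkmax le_rfl] at h2
    have h3 := ih (R.mem_Q_of_le hm (by rw [h1]; omega))
    rw [h1, pow_succ]
    have h4 := mul_le_mul_of_nonneg_left h3 hq0
    linarith

/-- Completed cycles contribute one factor q each, and the current, possibly incomplete, cycle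
contributes one more. -/
lemma resNorm_le {q : ℝ} (hq0 : 0 ≤ q) {kmax : ℕ} {ℓ : ℕ}
    (hq : ∀ k, (ℓ, k) ∈ R.Q → 1 ≤ k → R.resNorm ℓ k ≤ q * R.resNorm ℓ (gmresStart kmax k))
    (hkmax : 1 ≤ kmax) {k : ℕ} (hk : (ℓ, k) ∈ R.Q) (hk1 : 1 ≤ k) :
    R.resNorm ℓ k ≤ q ^ ((k - 1) / kmax + 1) * R.resNorm ℓ 0 := by
  have hle : gmresStart kmax k ≤ k := by
    have := Nat.div_mul_le_self (k - 1) kmax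
    simp only [gmresStart]
    omega
  have h1 := R.resNorm_le_pow hq0 hq hkmax ((k - 1) / kmax) (R.mem_Q_of_le hk hle)
  have h2 := hq k hk hk1
  have h3 := mul_le_mul_of_nonneg_left h1 hq0
  rw [pow_succ]
  have h4 : gmresStart kmax k = (k - 1) / kmax * kmax := rfl
  rw [h4] at h2
  linarith

end Iteration

/-! ### Convergence of the adaptive algorithm -/

namespace Iteration

variable {d : ℕ} {D : Problem d} {p : ℕ} (R : Iteration D p)

lemma reached_zero : R.Reached 0 := fun _ h => absurd h (Nat.not_lt_zero _)

lemma Reached.succ {R : Iteration D p} {ℓ k : ℕ} (h : R.Reached ℓ) (hk : R.IsFinal ℓ k) :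
    R.Reached (ℓ + 1) := fun ℓ' hℓ' => by
  rcases Nat.lt_succ_iff_lt_or_eq.1 hℓ' with h1 | rfl
  · exact h ℓ' h1
  · exact ⟨k, hk⟩

lemma Reached.mono {R : Iteration D p} {ℓ ℓ' : ℕ} (h : R.Reached ℓ) (hle : ℓ' ≤ ℓ) :
    R.Reached ℓ' := fun ℓ'' h' => h ℓ'' (lt_of_lt_of_le h' hle)

lemma u_mem (ℓ k : ℕ) : R.u ℓ k ∈ feSpace D.Ω p (R.mesh ℓ) := R.fn_mem ℓ _

lemma le_of_mem_Q {ℓ j k : ℕ} (hj : (ℓ, j) ∈ R.Q) (hk : R.IsFinal ℓ k) : j ≤ k := by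
  by_contra h
  exact hj.2 k hk.1 (not_le.1 h) hk.2.1

/-- Sum of the errors and estimators in the convergence statement. -/
noncomputable def totalError (uStar : H10 D.Ω) (uL : ℕ → H10 D.Ω) (ℓ : ℕ) (v : H10 D.Ω) : ℝ :=
  D.enorm (uStar - v) + D.enorm (uStar - uL ℓ) + D.enorm (uL ℓ - v) +
    D.eta (R.mesh ℓ) (R.mesh ℓ) (uL ℓ) + D.eta (R.mesh ℓ) (R.mesh ℓ) v

lemma totalError_nonneg (uStar : H10 D.Ω) (uL : ℕ → H10 D.Ω) (ℓ : ℕ) (v : H10 D.Ω) :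
    0 ≤ R.totalError uStar uL ℓ v := by
  have h : ∀ w : H10 D.Ω, 0 ≤ D.enorm w := fun w => Real.sqrt_nonneg _
  exact add_nonneg (add_nonneg (add_nonneg (add_nonneg (h _) (h _)) (h _)) (D.eta_nonneg _ _ _))
    (D.eta_nonneg _ _ _)

/-- Properties of the algorithm that hold with constants that are uniform over all levels. -/
structure UniformBounds (kmax : ℕ) (uStar : H10 D.Ω) (uL : ℕ → H10 D.Ω) (C q : ℝ) : Prop where
  C_pos : 0 < C
  q_nonneg : 0 ≤ q
  q_lt_one : q < 1
  error_le : ∀ ℓ k, R.Reached ℓ → ‖uL ℓ - R.u ℓ k‖ ≤ C * R.resNorm ℓ k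
  res_le : ∀ ℓ k, R.Reached ℓ → R.resNorm ℓ k ≤ C * ‖uL ℓ - R.u ℓ k‖
  res_contraction : ∀ ℓ k, (ℓ, k) ∈ R.Q → 1 ≤ k →
    R.resNorm ℓ k ≤ q * R.resNorm ℓ (gmresStart kmax k)
  quasi_opt : ∀ ℓ k, R.Reached ℓ → ‖uL ℓ - R.u ℓ k‖ ≤ C * ‖uStar - R.u ℓ k‖
  total_le : ∀ ℓ k, R.Reached ℓ → R.totalError uStar uL ℓ (R.u ℓ k) ≤
    C * (‖uL ℓ - R.u ℓ k‖ + D.eta (R.mesh ℓ) (R.mesh ℓ) (R.u ℓ k))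
  norm_le : ∀ ℓ k, ‖uStar - R.u ℓ k‖ ≤ C * R.totalError uStar uL ℓ (R.u ℓ k)
  eta_le : ∀ ℓ j k, R.Reached ℓ → D.eta (R.mesh ℓ) (R.mesh ℓ) (R.u ℓ j) ≤
    D.eta (R.mesh ℓ) (R.mesh ℓ) (R.u ℓ k) + C * ‖R.u ℓ j - R.u ℓ k‖
  eta_succ_le : ∀ ℓ k, R.Reached ℓ → R.IsFinal ℓ k →
    D.eta (R.mesh (ℓ + 1)) (R.mesh (ℓ + 1)) (R.u (ℓ + 1) 0) ≤
      q * D.eta (R.mesh ℓ) (R.mesh ℓ) (R.u ℓ k)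
  nested : ∀ ℓ k, R.Reached ℓ → R.IsFinal ℓ k → R.u (ℓ + 1) 0 = R.u ℓ k

lemma IsGenerated.nvbMesh {R : Iteration D p} {𝒯₀ : Mesh d} {θ Cmark Calg lam : ℝ} {kmax : ℕ}
    {u₀ : H10 D.Ω} (hR : R.IsGenerated 𝒯₀ θ Cmark Calg lam kmax u₀)
    (hT : IsTriangulation D.Ω 𝒯₀) {ℓ : ℕ} (hℓ : R.Reached ℓ) : NVBMesh 𝒯₀ (R.mesh ℓ) := by
  cases ℓ with
  | zero => rw [hR.mesh_zero]; exact hT.nvbMesh_self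
  | succ ℓ =>
    obtain ⟨k, hk⟩ := hℓ ℓ (Nat.lt_succ_self ℓ)
    exact (hR.refine_mesh ℓ k (hℓ.mono (Nat.le_succ ℓ)) hk).mesh

/-- Reliability bounds the discretization error by the estimator at the Galerkin solution, stability
moves the estimator to v, and the triangle inequality does the rest. -/
lemma totalError_le {β C : ℝ} (hβ : 0 < β) (hC : 0 < C)
    (heq : ∀ v : H10 D.Ω, D.enorm v ≤ β * ‖v‖) {uStar : H10 D.Ω} {uL : ℕ → H10 D.Ω} {ℓ : ℕ}
    {v : H10 D.Ω}
    (hrel : ‖uStar - uL ℓ‖ ≤ C * D.eta (R.mesh ℓ) (R.mesh ℓ) (uL ℓ))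
    (hstab : D.eta (R.mesh ℓ) (R.mesh ℓ) (uL ℓ) ≤
      D.eta (R.mesh ℓ) (R.mesh ℓ) v + C * ‖uL ℓ - v‖) :
    R.totalError uStar uL ℓ v ≤ (2 * β * (C + C ^ 2 + 1) + 2 + C) *
      (‖uL ℓ - v‖ + D.eta (R.mesh ℓ) (R.mesh ℓ) v) := by
  have h1 := heq (uStar - v)
  have h2 := heq (uStar - uL ℓ)
  have h3 := heq (uL ℓ - v)
  have h4 : ‖uStar - v‖ ≤ ‖uStar - uL ℓ‖ + ‖uL ℓ - v‖ := norm_sub_le_norm_sub_add_norm_sub _ _ _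
  have h5 := norm_nonneg (uL ℓ - v)
  have h6 := D.eta_nonneg (R.mesh ℓ) (R.mesh ℓ) v
  rw [totalError]
  set x := ‖uL ℓ - v‖
  set y := D.eta (R.mesh ℓ) (R.mesh ℓ) v
  have h7 := mul_le_mul_of_nonneg_left hstab hC.le
  have h8 : ‖uStar - uL ℓ‖ ≤ C * (y + C * x) := hrel.trans h7
  have h9 := mul_le_mul_of_nonneg_left h8 hβ.le
  have h10 := mul_le_mul_of_nonneg_left h4 hβ.le
  have h11 : 0 ≤ β * x := mul_nonneg hβ.le h5
  have h12 : 0 ≤ β * y := mul_nonneg hβ.le h6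
  have h13 : 0 ≤ β * C * x := mul_nonneg (mul_nonneg hβ.le hC.le) h5
  have h14 : 0 ≤ β * C ^ 2 * y := mul_nonneg (mul_nonneg hβ.le (sq_nonneg C)) h6
  have h15 : 0 ≤ C * y := mul_nonneg hC.le h6
  linarith

theorem exists_uniformBounds (hd : 1 ≤ d) {𝒯₀ : Mesh d} (hD : D.IsAdmissible 𝒯₀)
    (hη : D.EstimatorAxioms p 𝒯₀) {θ Cmark Calg lam : ℝ} (hθ : 0 < θ) (hθ' : θ ≤ 1) {kmax : ℕ}
    (hkmax : 1 ≤ kmax) {u₀ : H10 D.Ω} (hR : R.IsGenerated 𝒯₀ θ Cmark Calg lam kmax u₀)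
    (hP : R.OptimalPreconditioner) {uStar : H10 D.Ω} (huStar : D.IsSolutionIn ⊤ uStar)
    {uL : ℕ → H10 D.Ω}
    (huL : ∀ ℓ, R.Reached ℓ → D.IsSolutionIn (feSpace D.Ω p (R.mesh ℓ)) (uL ℓ)) :
    ∃ C q : ℝ, R.UniformBounds kmax uStar uL C q := by
  obtain ⟨A, α, β, hα, hβ, hA, hco, heq⟩ := hD.exists_coercive_form hd
  obtain ⟨μ, hμ, hbd⟩ := exists_bound_bilin A
  obtain ⟨C₁, q₁, hC₁, hq₁, hq₁', hsol₁, hsol₂, hsol₃⟩ :=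
    R.exists_solver_constants hα hβ hμ hA hco hbd heq hkmax hR hP huL
  obtain ⟨C₂, q₂, hC₂, hq₂, hq₂', hstab, hrel, hred⟩ :=
    hη.exists_constants hθ hθ' hα hβ heq
  set C₃ := 2 * β * (C₂ + C₂ ^ 2 + 1) + 2 + C₂ with hC₃
  have hC₃0 : 0 < C₃ := by positivity
  have hμα : 0 < μ / α := div_pos hμ hα
  have hα' : 0 < α⁻¹ := inv_pos.2 hα
  have hmul : ∀ {a b c x : ℝ}, a ≤ b * x → b ≤ c → 0 ≤ x → a ≤ c * x :=
    fun h1 h2 h3 => h1.trans (mul_le_mul_of_nonneg_right h2 h3)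
  have hgal : ∀ ℓ, R.Reached ℓ → ∀ v ∈ feSpace D.Ω p (R.mesh ℓ), A (uL ℓ) v = A uStar v :=
    fun ℓ hℓ v hv => by
      rw [hA, hA, (huL ℓ hℓ).2 v hv, huStar.2 v Submodule.mem_top]
  -- The sum dominates the solver, estimator, total-error and quasi-optimality constants; α⁻¹
  -- converts the energy norm into the H¹-norm.
  refine ⟨C₁ + C₂ + C₃ + μ / α + α⁻¹, max q₁ q₂, by linarith, le_max_of_le_left hq₁,
    max_lt hq₁' hq₂', fun ℓ k hℓ => ?_, fun ℓ k hℓ => ?_, fun ℓ k hk hk1 => ?_, fun ℓ k hℓ => ?_,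
    fun ℓ k hℓ => ?_, fun ℓ k => ?_, fun ℓ j k hℓ => ?_, fun ℓ k hℓ hk => ?_, hR.nested⟩
  · exact hmul (hsol₁ ℓ k hℓ) (by linarith) (R.resNorm_nonneg ℓ k)
  · exact hmul (hsol₂ ℓ k hℓ) (by linarith) (norm_nonneg _)
  · exact hmul (hsol₃ ℓ k hk hk1) (le_max_left _ _) (R.resNorm_nonneg _ _)
  · exact hmul (norm_galerkin_sub_le hα hμ hco hbd (huL ℓ hℓ).1 (hgal ℓ hℓ) (R.u_mem ℓ k))
      (by linarith) (norm_nonneg _)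
  · have hN := hR.nvbMesh hD.triangulation hℓ
    exact hmul (R.totalError_le hβ hC₂ (fun v => (heq v).2)
      (hrel _ hN _ _ huStar (huL ℓ hℓ)) (hstab _ hN _ (huL ℓ hℓ).1 _ (R.u_mem ℓ k)))
      (by linarith) (add_nonneg (norm_nonneg _) (D.eta_nonneg _ _ _))
  · have h1 : D.enorm (uStar - R.u ℓ k) ≤ R.totalError uStar uL ℓ (R.u ℓ k) := by
      have h : ∀ w : H10 D.Ω, 0 ≤ D.enorm w := fun w => Real.sqrt_nonneg _
      rw [totalError]
      linarith [h (uStar - uL ℓ), h (uL ℓ - R.u ℓ k),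
        D.eta_nonneg (R.mesh ℓ) (R.mesh ℓ) (uL ℓ), D.eta_nonneg (R.mesh ℓ) (R.mesh ℓ) (R.u ℓ k)]
    have h2 : ‖uStar - R.u ℓ k‖ ≤ α⁻¹ * R.totalError uStar uL ℓ (R.u ℓ k) := by
      rw [← div_eq_inv_mul, le_div_iff₀' hα]
      exact (heq _).1.trans h1
    exact hmul h2 (by linarith) (R.totalError_nonneg _ _ _ _)
  · have h1 := hstab _ (hR.nvbMesh hD.triangulation hℓ) _ (R.u_mem ℓ j) _ (R.u_mem ℓ k)
    refine h1.trans (add_le_add le_rfl (hmul le_rfl (by linarith) (norm_nonneg _)))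
  · rw [hR.nested ℓ k hℓ hk]
    exact hmul (hred _ _ _ (hR.nvbMesh hD.triangulation hℓ) (hR.refine_mesh ℓ k hℓ hk)
      (hR.mark_subset ℓ k hℓ hk) _ (R.u_mem ℓ k) (hR.mark_doerfler ℓ k hℓ hk))
      (le_max_right _ _) (D.eta_nonneg _ _ _)

end Iteration

namespace Iteration

variable {d : ℕ} {D : Problem d} {p : ℕ} {R : Iteration D p} {kmax : ℕ} {uStar : H10 D.Ω}
  {uL : ℕ → H10 D.Ω} {C q : ℝ}

lemma UniformBounds.resNorm_le_resNorm_zero (hB : R.UniformBounds kmax uStar uL C q)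
    (hkmax : 1 ≤ kmax) {ℓ k : ℕ} (hk : (ℓ, k) ∈ R.Q) : R.resNorm ℓ k ≤ R.resNorm ℓ 0 := by
  rcases Nat.eq_zero_or_pos k with rfl | h
  · exact le_rfl
  · refine (R.resNorm_le hB.q_nonneg (hB.res_contraction ℓ) hkmax hk h).trans ?_
    exact mul_le_of_le_one_left (R.resNorm_nonneg _ _) (pow_le_one₀ hB.q_nonneg hB.q_lt_one.le)

lemma quasiError_nonneg (ℓ k : ℕ) : 0 ≤ R.quasiError ℓ k :=
  add_nonneg (D.eta_nonneg _ _ _) (R.resNorm_nonneg _ _)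

/-- All errors on a level are controlled by the final quasi-error of the previous level. -/
lemma UniformBounds.exists_totalError_succ_le (hB : R.UniformBounds kmax uStar uL C q)
    (hkmax : 1 ≤ kmax) : ∃ K : ℝ, 0 < K ∧ ∀ ℓ k j, R.Reached ℓ → R.IsFinal ℓ k →
      (ℓ + 1, j) ∈ R.Q →
        R.totalError uStar uL (ℓ + 1) (R.u (ℓ + 1) j) ≤ K * R.quasiError ℓ k := by
  have hC := hB.C_pos
  -- One constant per link: total error at the end of level ℓ, then algebraic error of the nested
  -- initial guess, residual of any iterate on level ℓ+1, and its algebraic error.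
  set K₁ := C * (C + 1) with hK₁
  set K₃ := C * (C * K₁) with hK₃
  set K₄ := C * K₃ with hK₄
  set K₅ := C * K₄ with hK₅
  have h1 : 0 < K₁ := by positivity
  refine ⟨C * (K₅ + (1 + C * (K₅ + K₃))), by positivity, fun ℓ k j hℓ hk hj => ?_⟩
  have hℓ' := hj.1
  have hr := R.resNorm_nonneg ℓ k
  have he := D.eta_nonneg (R.mesh ℓ) (R.mesh ℓ) (R.u ℓ k)
  have hH : R.quasiError ℓ k = D.eta (R.mesh ℓ) (R.mesh ℓ) (R.u ℓ k) + R.resNorm ℓ k := rfl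
  have a1 : R.totalError uStar uL ℓ (R.u ℓ k) ≤ K₁ * R.quasiError ℓ k := by
    have b1 := hB.total_le ℓ k hℓ
    have b2 := mul_le_mul_of_nonneg_left (hB.error_le ℓ k hℓ) hC.le
    have b3 : 0 ≤ C * R.resNorm ℓ k := mul_nonneg hC.le hr
    have b4 : 0 ≤ C * C * D.eta (R.mesh ℓ) (R.mesh ℓ) (R.u ℓ k) :=
      mul_nonneg (mul_nonneg hC.le hC.le) he
    rw [hH, hK₁]
    linarith
  have a2 : ‖uStar - R.u ℓ k‖ ≤ C * K₁ * R.quasiError ℓ k := by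
    have b1 := mul_le_mul_of_nonneg_left a1 hC.le
    linarith [hB.norm_le ℓ k]
  have a3 : ‖uL (ℓ + 1) - R.u (ℓ + 1) 0‖ ≤ K₃ * R.quasiError ℓ k := by
    have b1 := hB.quasi_opt (ℓ + 1) 0 hℓ'
    rw [hB.nested ℓ k hℓ hk] at b1 ⊢
    have b2 := mul_le_mul_of_nonneg_left a2 hC.le
    rw [hK₃]
    linarith
  have a4 : R.resNorm (ℓ + 1) j ≤ K₄ * R.quasiError ℓ k := by
    have b1 := hB.res_le (ℓ + 1) 0 hℓ'
    have b2 := mul_le_mul_of_nonneg_left a3 hC.le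
    rw [hK₄]
    linarith [hB.resNorm_le_resNorm_zero hkmax hj]
  have a5 : ‖uL (ℓ + 1) - R.u (ℓ + 1) j‖ ≤ K₅ * R.quasiError ℓ k := by
    have b1 := hB.error_le (ℓ + 1) j hℓ'
    have b2 := mul_le_mul_of_nonneg_left a4 hC.le
    rw [hK₅]
    linarith
  have a6 : ‖R.u (ℓ + 1) j - R.u (ℓ + 1) 0‖ ≤ (K₅ + K₃) * R.quasiError ℓ k := by
    have b1 := norm_sub_le_norm_sub_add_norm_sub (R.u (ℓ + 1) j) (uL (ℓ + 1)) (R.u (ℓ + 1) 0)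
    rw [norm_sub_rev (R.u (ℓ + 1) j) (uL (ℓ + 1))] at b1
    linarith
  -- The estimator is compared with its value at the initial guess, which estimator reduction bounds
  -- by the previous level.
  have a7 := hB.eta_le (ℓ + 1) j 0 hℓ'
  have a8 := hB.eta_succ_le ℓ k hℓ hk
  have a9 := mul_le_mul_of_nonneg_right hB.q_lt_one.le he
  have a10 := mul_le_mul_of_nonneg_left a6 hC.le
  have a11 : D.eta (R.mesh (ℓ + 1)) (R.mesh (ℓ + 1)) (R.u (ℓ + 1) j) ≤
      (1 + C * (K₅ + K₃)) * R.quasiError ℓ k := by linarith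
  have a12 := mul_le_mul_of_nonneg_left (add_le_add a5 a11) hC.le
  refine (hB.total_le (ℓ + 1) j hℓ').trans (a12.trans_eq (by ring))

/-- Convergence of the iterates if the solver does not terminate. -/
lemma UniformBounds.tendsto_totalError (hB : R.UniformBounds kmax uStar uL C q)
    (hkmax : 1 ≤ kmax) {ℓ : ℕ} (hℓ : R.Reached ℓ) (hlam : 0 < R.lam ℓ)
    (hnot : ∀ k, 1 ≤ k → ¬ R.Stops ℓ k) :
    Tendsto (fun k => R.totalError uStar uL ℓ (R.u ℓ k)) atTop (𝓝 0) := by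
  have hC := hB.C_pos
  have hQ : ∀ k, (ℓ, k) ∈ R.Q := fun k => ⟨hℓ, fun j hj _ => hnot j hj⟩
  have hdiv : Tendsto (fun k => (k - 1) / kmax + 1) atTop atTop := by
    refine tendsto_atTop.2 fun b => eventually_atTop.2 ⟨b * kmax + 1, fun k hk => ?_⟩
    have := (Nat.le_div_iff_mul_le (show 0 < kmax from hkmax)).2
      (show b * kmax ≤ k - 1 by omega)
    omega
  have hpow := (tendsto_pow_atTop_nhds_zero_of_lt_one hB.q_nonneg hB.q_lt_one).comp hdiv
  have hlim : Tendsto (fun k => C * (C + (R.lam ℓ)⁻¹) *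
      (q ^ ((k - 1) / kmax + 1) * R.resNorm ℓ 0)) atTop (𝓝 0) := by
    simpa using (hpow.mul_const (R.resNorm ℓ 0)).const_mul (C * (C + (R.lam ℓ)⁻¹))
  refine squeeze_zero' (Eventually.of_forall fun k => R.totalError_nonneg _ _ _ _)
    (eventually_atTop.2 ⟨1, fun k hk => ?_⟩) hlim
  have h1 := R.resNorm_le hB.q_nonneg (hB.res_contraction ℓ) hkmax (hQ k) hk
  -- The violated stopping criterion bounds the estimator by the residual.
  have h2 : D.eta (R.mesh ℓ) (R.mesh ℓ) (R.u ℓ k) ≤ (R.lam ℓ)⁻¹ * R.resNorm ℓ k := by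
    rw [← div_eq_inv_mul, le_div_iff₀' hlam]
    exact (not_le.1 (hnot k hk)).le
  have h3 := mul_le_mul_of_nonneg_left (add_le_add (hB.error_le ℓ k hℓ) h2) hC.le
  have h4 : 0 ≤ C * (C + (R.lam ℓ)⁻¹) := by positivity
  have h5 := mul_le_mul_of_nonneg_left h1 h4
  linarith [hB.total_le ℓ k hℓ]

/-- Absorbing l' e' gives (1 - τ) e' ≤ (q + τ) e + c d. For τ = (1 - q)/4 one has (q + τ)/(1 - τ) ≤
(1 + q)/2, which amounts to (1 - q)² ≥ 0, and 1/(1 - τ) ≤ 2. -/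
lemma contraction_of_perturbed {q τ e e' l l' c d : ℝ} (hτ : τ = (1 - q) / 4) (hq0 : 0 ≤ q)
    (hq1 : q < 1) (he : 0 ≤ e) (he' : 0 ≤ e') (hd : 0 ≤ c * d) (hl : l ≤ τ) (hl' : l' ≤ τ)
    (h : e' ≤ q * e + l' * e' + l * e + c * d) : e' ≤ (1 + q) / 2 * e + 2 * c * d := by
  have h1 := mul_le_mul_of_nonneg_right hl he
  have h2 := mul_le_mul_of_nonneg_right hl' he'
  have h3 : 0 ≤ (1 - q) ^ 2 * e := by positivity
  have h4 : 0 ≤ (1 - q) * (c * d) := mul_nonneg (by linarith) hd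
  have h5 : 0 ≤ q * (c * d) := mul_nonneg hq0 hd
  subst hτ
  refine le_of_mul_le_mul_left ?_ (show 0 < 1 - (1 - q) / 4 by linarith)
  linarith

/-- Estimator convergence for vanishing solver tolerance. -/
lemma UniformBounds.tendsto_eta (hB : R.UniformBounds kmax uStar uL C q) {kf : ℕ → ℕ}
    (hreach : ∀ ℓ, R.Reached ℓ) (hkf : ∀ ℓ, R.IsFinal ℓ (kf ℓ))
    (hlam : Tendsto R.lam atTop (𝓝 0))
    (hd : Tendsto (fun ℓ => ‖uL (ℓ + 1) - uL ℓ‖) atTop (𝓝 0)) :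
    Tendsto (fun ℓ => D.eta (R.mesh ℓ) (R.mesh ℓ) (R.u ℓ (kf ℓ))) atTop (𝓝 0) := by
  have hC := hB.C_pos
  have hq0 := hB.q_nonneg
  have hq1 := hB.q_lt_one
  have hd' : Tendsto (fun ℓ => 2 * C * ‖uL (ℓ + 1) - uL ℓ‖) atTop (𝓝 0) := by
    simpa using hd.const_mul (2 * C)
  refine tendsto_zero_of_perturbed_contraction (q := (1 + q) / 2) (by linarith) (by linarith)
    (fun ℓ => D.eta_nonneg _ _ _) hd' ?_
  -- One factor C stems from stability, the other from bounding the algebraic error by the residual.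
  have hl : Tendsto (fun ℓ => C * C * R.lam ℓ) atTop (𝓝 0) := by
    simpa using hlam.const_mul (C * C)
  have hτ : 0 < (1 - q) / 4 := by linarith
  have hev := (hl.eventually_lt_const hτ)
  filter_upwards [hev, (tendsto_add_atTop_nat 1).eventually hev] with ℓ h1 h2
  refine contraction_of_perturbed rfl hq0 hq1 (D.eta_nonneg _ _ _) (D.eta_nonneg _ _ _)
    (mul_nonneg hC.le (norm_nonneg _)) h1.le h2.le ?_
  have a1 := hB.eta_le (ℓ + 1) (kf (ℓ + 1)) 0 (hreach _)
  have a2 := hB.eta_succ_le ℓ (kf ℓ) (hreach ℓ) (hkf ℓ)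
  have a3 := hB.error_le (ℓ + 1) (kf (ℓ + 1)) (hreach _)
  have a4 := hB.error_le ℓ (kf ℓ) (hreach _)
  have a5 := mul_le_mul_of_nonneg_left (hkf ℓ).2.1 hC.le
  have a6 := mul_le_mul_of_nonneg_left (hkf (ℓ + 1)).2.1 hC.le
  -- The change between final iterates is routed through both Galerkin solutions; the two algebraic
  -- errors are controlled by the stopping criterion.
  have a7 : ‖R.u (ℓ + 1) (kf (ℓ + 1)) - R.u (ℓ + 1) 0‖ ≤
      ‖uL (ℓ + 1) - R.u (ℓ + 1) (kf (ℓ + 1))‖ + ‖uL (ℓ + 1) - uL ℓ‖ +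
        ‖uL ℓ - R.u ℓ (kf ℓ)‖ := by
    rw [hB.nested ℓ (kf ℓ) (hreach ℓ) (hkf ℓ), norm_sub_rev (uL (ℓ + 1)) (R.u _ _), add_assoc]
    exact (norm_sub_le_norm_sub_add_norm_sub _ (uL (ℓ + 1)) _).trans
      (add_le_add le_rfl (norm_sub_le_norm_sub_add_norm_sub _ (uL ℓ) _))
  have a8 := mul_le_mul_of_nonneg_left
    (a7.trans (add_le_add (add_le_add (a3.trans a6) le_rfl) (a4.trans a5))) hC.le
  linarith

/-! ### Adaptive parameter control and convergence of the final quasi-errors. -/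

variable {𝒯₀ : Mesh d} {θ Cmark Calg lam : ℝ} {u₀ : H10 D.Ω}

lemma IsGenerated.parameters_pos (hR : R.IsGenerated 𝒯₀ θ Cmark Calg lam kmax u₀)
    (hCalg : 0 < Calg) (hlam : 0 < lam) {ℓ : ℕ} (hℓ : R.Reached ℓ) :
    0 < R.Calg ℓ ∧ 0 < R.lam ℓ := by
  induction ℓ with
  | zero => rw [hR.Calg_zero, hR.lam_zero]; exact ⟨hCalg, hlam⟩
  | succ ℓ ih =>
    have hℓ' := hℓ.mono (Nat.le_succ ℓ)
    obtain ⟨k, hk⟩ := hℓ ℓ (Nat.lt_succ_self ℓ)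
    obtain ⟨h1, h2⟩ := ih hℓ'
    by_cases hu : 1 ≤ ℓ ∧
        ENNReal.ofReal (R.Calg ℓ) * (ENNReal.ofReal (R.quasiError ℓ k))⁻¹ < R.S ℓ
    · obtain ⟨h3, h4⟩ := hR.control_update ℓ k hℓ' hk hu
      rw [h3, h4]
      exact ⟨by linarith, by linarith⟩
    · obtain ⟨h3, h4⟩ := hR.control_keep ℓ k hℓ' hk hu
      rw [h3, h4]
      exact ⟨h1, h2⟩

/-- The Galerkin solutions converge if all levels are reached. -/
lemma IsGenerated.tendsto_norm_galerkin_sub (hd : 1 ≤ d) (hD : D.IsAdmissible 𝒯₀)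
    (hR : R.IsGenerated 𝒯₀ θ Cmark Calg lam kmax u₀) (huStar : D.IsSolutionIn ⊤ uStar)
    (huL : ∀ ℓ, R.Reached ℓ → D.IsSolutionIn (feSpace D.Ω p (R.mesh ℓ)) (uL ℓ)) {kf : ℕ → ℕ}
    (hreach : ∀ ℓ, R.Reached ℓ) (hkf : ∀ ℓ, R.IsFinal ℓ (kf ℓ)) :
    Tendsto (fun ℓ => ‖uL (ℓ + 1) - uL ℓ‖) atTop (𝓝 0) := by
  obtain ⟨A, α, β, hα, -, hA, hco, -⟩ := hD.exists_coercive_form hd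
  have : CompleteSpace (H10 D.Ω) := (Submodule.isClosed_topologicalClosure _).completeSpace_coe
  obtain ⟨w, hw⟩ := exists_tendsto_galerkin hα hco (X := fun ℓ => feSpace D.Ω p (R.mesh ℓ))
    (monotone_nat_of_le_succ fun ℓ =>
      feSpace_mono (hR.refine_mesh ℓ (kf ℓ) (hreach ℓ) (hkf ℓ)).bisects)
    (u := uStar) (uX := uL) (fun ℓ => (huL ℓ (hreach ℓ)).1)
    (fun ℓ v hv => by rw [hA, hA, (huL ℓ (hreach ℓ)).2 v hv, huStar.2 v Submodule.mem_top])
  have h := ((hw.comp (tendsto_add_atTop_nat 1)).sub hw).norm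
  simpa using h

/-- The final quasi-errors converge to zero if all levels are reached. -/
lemma IsGenerated.tendsto_quasiError (hd : 1 ≤ d) (hD : D.IsAdmissible 𝒯₀)
    (hR : R.IsGenerated 𝒯₀ θ Cmark Calg lam kmax u₀) (hCalg : 0 < Calg) (hlam : 0 < lam)
    (hB : R.UniformBounds kmax uStar uL C q) (huStar : D.IsSolutionIn ⊤ uStar)
    (huL : ∀ ℓ, R.Reached ℓ → D.IsSolutionIn (feSpace D.Ω p (R.mesh ℓ)) (uL ℓ)) {kf : ℕ → ℕ}
    (hreach : ∀ ℓ, R.Reached ℓ) (hkf : ∀ ℓ, R.IsFinal ℓ (kf ℓ)) :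
    Tendsto (fun ℓ => R.quasiError ℓ (kf ℓ)) atTop (𝓝 0) := by
  by_cases hfreq : ∃ᶠ ℓ in atTop, 1 ≤ ℓ ∧
      ENNReal.ofReal (R.Calg ℓ) * (ENNReal.ofReal (R.quasiError ℓ (kf ℓ)))⁻¹ < R.S ℓ
  -- Infinitely many updates: λ tends to zero, and so does the estimator; the stopping criterion
  -- then takes care of the residual.
  · have hl : Tendsto R.lam atTop (𝓝 0) :=
      tendsto_zero_of_frequently_half (by rw [hR.lam_zero]; exact hlam)
        (fun ℓ h => (hR.control_update ℓ (kf ℓ) (hreach ℓ) (hkf ℓ) h).2)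
        (fun ℓ h => (hR.control_keep ℓ (kf ℓ) (hreach ℓ) (hkf ℓ) h).2) hfreq
    have he := hB.tendsto_eta hreach hkf hl
      (hR.tendsto_norm_galerkin_sub hd hD huStar huL hreach hkf)
    have hlim : Tendsto (fun ℓ => D.eta (R.mesh ℓ) (R.mesh ℓ) (R.u ℓ (kf ℓ)) +
        R.lam ℓ * D.eta (R.mesh ℓ) (R.mesh ℓ) (R.u ℓ (kf ℓ))) atTop (𝓝 0) := by
      simpa using he.add (hl.mul he)
    exact squeeze_zero (fun ℓ => quasiError_nonneg ℓ _)
      (fun ℓ => add_le_add le_rfl (hkf ℓ).2.1) hlim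
  -- Finitely many updates: `Calg` is eventually constant. The maximum with 1 is needed because no
  -- test is made on level 0.
  · obtain ⟨L, hL⟩ := eventually_atTop.1 (not_frequently.1 hfreq)
    have hconst : ∀ n, R.Calg (max L 1 + n) = R.Calg (max L 1) := by
      intro n
      induction n with
      | zero => rfl
      | succ n ih =>
        rw [← add_assoc, (hR.control_keep _ _ (hreach _) (hkf _) (hL _ (by omega))).1, ih]
    refine tendsto_zero_of_sum_inv_le (S := R.S) (L := max L 1)
      (hR.parameters_pos hCalg hlam (hreach (max L 1))).1 (fun ℓ => quasiError_nonneg ℓ _)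
      (fun ℓ => hR.control_S ℓ _ (hreach ℓ) (hkf ℓ)) fun ℓ hℓ => ?_
    obtain ⟨n, rfl⟩ := Nat.exists_eq_add_of_le hℓ
    have h1 := hL (max L 1 + n) (by omega)
    rw [not_and, not_lt] at h1
    rw [← hconst n]
    exact h1 (by omega)

/-- Only finitely many steps precede a level that is reached. -/
lemma Reached.finite_Q_lt {ℓ : ℕ} (hℓ : R.Reached ℓ) : {q ∈ R.Q | q.1 < ℓ}.Finite := by
  choose k hk using hℓ
  refine ((Set.finite_Iio ℓ).biUnion' (t := fun i hi => {i} ×ˢ Set.Iic (k i hi))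
    fun i hi => (Set.finite_singleton i).prod (Set.finite_Iic _)).subset ?_
  rintro ⟨i, j⟩ ⟨hQ, hi⟩
  exact Set.mem_iUnion₂.2 ⟨i, hi, rfl, R.le_of_mem_Q hQ (hk i hi)⟩

/-- A function on `Q` tends to zero along the step counter if all but finitely many of its values
are small. -/
lemma tendsto_steps_of_finite {f : ℕ × ℕ → ℝ} (hf : ∀ q, 0 ≤ f q)
    (hfin : ∀ ε > 0, {q ∈ R.Q | ε ≤ f q}.Finite) :
    Tendsto f (comap R.steps atTop ⊓ 𝓟 R.Q) (𝓝 0) := by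
  rw [Metric.tendsto_nhds]
  intro ε hε
  -- The step counter is bounded on the finite exceptional set; beyond that bound all values are
  -- small.
  obtain ⟨n, hn⟩ := ((hfin ε hε).image R.steps).bddAbove
  rw [eventually_inf_principal, eventually_comap]
  filter_upwards [eventually_gt_atTop n] with m hm q hq hQ
  rw [Real.dist_eq, sub_zero, abs_of_nonneg (hf q)]
  by_contra h
  have := hn ⟨q, ⟨hQ, not_lt.1 h⟩, hq⟩
  omega

end Iteration

end AFEM

/-! ### The convergence theorem. -/

theorem corollary5p5 {d : ℕ} (hd : 1 ≤ d) {p : ℕ} (hp : 1 ≤ p)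
    (D : AFEM.Problem d) (𝒯₀ : AFEM.Mesh d) (hD : D.IsAdmissible 𝒯₀)
    (hη : D.EstimatorAxioms p 𝒯₀)
    (θ Cmark Calg lam : ℝ) (hθ : 0 < θ) (hθ' : θ ≤ 1) (hCmark : 1 ≤ Cmark)
    (hCalg : 0 < Calg) (hlam : 0 < lam) (kmax : ℕ) (hkmax : 1 ≤ kmax)
    (u₀ : AFEM.H10 D.Ω) (hu₀ : u₀ ∈ AFEM.feSpace D.Ω p 𝒯₀)
    (R : AFEM.Iteration D p) (hR : R.IsGenerated 𝒯₀ θ Cmark Calg lam kmax u₀)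
    (hP : R.OptimalPreconditioner)
    (uStar : AFEM.H10 D.Ω) (huStar : D.IsSolutionIn ⊤ uStar)
    (uStarL : ℕ → AFEM.H10 D.Ω)
    (huStarL : ∀ ℓ, R.Reached ℓ →
      D.IsSolutionIn (AFEM.feSpace D.Ω p (R.mesh ℓ)) (uStarL ℓ)) :
    Filter.Tendsto
      (fun q : ℕ × ℕ =>
        D.enorm (uStar - R.u q.1 q.2) + D.enorm (uStar - uStarL q.1) +
          D.enorm (uStarL q.1 - R.u q.1 q.2) +
          D.eta (R.mesh q.1) (R.mesh q.1) (uStarL q.1) +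
          D.eta (R.mesh q.1) (R.mesh q.1) (R.u q.1 q.2))
      (Filter.comap R.steps Filter.atTop ⊓ Filter.principal R.Q) (nhds 0) := by
  obtain ⟨C, q, hB⟩ := R.exists_uniformBounds hd hD hη hθ hθ' hkmax hR hP huStar huStarL
  refine AFEM.Iteration.tendsto_steps_of_finite
    (f := fun q => R.totalError uStar uStarL q.1 (R.u q.1 q.2))
    (fun q => R.totalError_nonneg _ _ _ _) fun ε hε => ?_
  -- Either some reached level never stops, and is then the last one, or all levels are reached.
  by_cases hlast : ∃ ℓ, R.Reached ℓ ∧ ∀ k, ¬ R.IsFinal ℓ k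
  · obtain ⟨ℓ, hℓ, hnot⟩ := hlast
    have hnot' : ∀ k, 1 ≤ k → ¬ R.Stops ℓ k := by
      intro k
      induction k using Nat.strong_induction_on with
      | _ k ih => exact fun hk hs => hnot k ⟨hk, hs, fun j h1 h2 => ih j h2 h1⟩
    have hlim := hB.tendsto_totalError hkmax hℓ (hR.parameters_pos hCalg hlam hℓ).2 hnot'
    obtain ⟨K, hK⟩ := Filter.eventually_atTop.1 (hlim.eventually_lt_const hε)
    refine (hℓ.finite_Q_lt.union ((Set.finite_singleton ℓ).prod (Set.finite_Iio K))).subset ?_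
    rintro ⟨i, j⟩ ⟨hQ, hle⟩
    rcases lt_trichotomy i ℓ with h | rfl | h
    · exact Or.inl ⟨hQ, h⟩
    · refine Or.inr ⟨rfl, ?_⟩
      by_contra hj
      exact absurd (hK j (not_lt.1 hj)) (not_lt.2 hle)
    · obtain ⟨k, hk⟩ := hQ.1 ℓ h
      exact absurd hk (hnot k)
  · push Not at hlast
    have hreach : ∀ ℓ, R.Reached ℓ := by
      intro ℓ
      induction ℓ with
      | zero => exact R.reached_zero
      | succ ℓ ih =>
        obtain ⟨k, hk⟩ := hlast ℓ ih
        exact ih.succ hk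
    choose kf hkf using fun ℓ => hlast ℓ (hreach ℓ)
    obtain ⟨K, hK, hle⟩ := hB.exists_totalError_succ_le hkmax
    have hlim := (hR.tendsto_quasiError hd hD hCalg hlam hB huStar huStarL hreach hkf).const_mul K
    rw [mul_zero] at hlim
    obtain ⟨L, hL⟩ := Filter.eventually_atTop.1 (hlim.eventually_lt_const hε)
    -- Iterates on levels above L are all small, being controlled by the quasi-error one level
    -- below.
    refine (hreach (L + 1)).finite_Q_lt.subset ?_
    rintro ⟨i, j⟩ ⟨hQ, hge⟩
    refine ⟨hQ, ?_⟩
    by_contra hi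
    obtain ⟨i, rfl⟩ : ∃ n, i = n + 1 := ⟨i - 1, by simp only at hi; omega⟩
    have h1 := hle i (kf i) j (hreach i) (hkf i) hQ
    have h2 := hL i (by simp only at hi; omega)
    exact absurd (h1.trans_lt h2) (not_lt.2 hge)
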